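/- Let $G$ be a locally compact (Hausdorff) group with a fixed (regular) left Haar measure $\lambda$, let $1<p<\infty$, and let $L^p(G)$ be the complex Lebesgue space of $(G,\lambda)$ with norm $\|\cdot\|_p$. For measurable $f,g:G\to\mathbb{C}$ put $(g*f)(x)=\int_G g(y)f(y^{-1}x)\,d\lambda(y)$; say that $g*f$ exists if $y\mapsto g(y)f(y^{-1}x)$ is $\lambda$-integrable for almost all $x\in G$. Let $L^T_p(G)$ be the set of all $f\in L^p(G)$ such that $g*f$ exists for every $g\in L^p(G)$ and $$\|f\|_p^T=\sup\{\|g*f\|_p:\ g\in L^p(G),\ \|g\|_p\le 1\}<\infty ,$$ and put $|||f|||_p^T=\|f\|_p+\|f\|_p^T$ for $f\in L^T_p(G)$. Consider the following assertions. (i) $L^p(G)=L^T_p(G)$ as sets. (ii) The norms $\|\cdot\|_p$ and $|||\cdot|||_p^T$ are equivalent on $L^T_p(G)$. (iii) There is a constant $K>0$ such that $\|f\|_p^T\le K\|f\|_p$ for every $f\in L^T_p(G)$. (iv) $G$ is compact. Then (i) $\Leftrightarrow$ (iv), (ii) $\Leftrightarrow$ (iii), and (iv) $\Rightarrow$ (iii).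 If moreover $G$ is unimodular and $1<p\le 2$, then all four assertions are equivalent. -/

import Mathlib

open MeasureTheory
open scoped ENNReal NNReal

namespace LpTempered

/-- The convolution `(g * f)(x) = ∫ g(y) f(y⁻¹ x) dμ(y)` of two complex functions on a group. -/
noncomputable def conv {G : Type*} [Group G] [MeasurableSpace G] (μ : Measure G)
    (g f : G → ℂ) (x : G) : ℂ :=
  ∫ y, g y * f (y⁻¹ * x) ∂μ

/-- `g * f` exists: for almost all `x`, the function `y ↦ g(y) f(y⁻¹ x)` is integrable. -/
def ConvExists {G : Type*} [Group G] [MeasurableSpace G] (μ : Measure G)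
    (g f : G → ℂ) : Prop :=
  ∀ᵐ x ∂μ, Integrable (fun y => g y * f (y⁻¹ * x)) μ

/-- `‖f‖_p^T = sup { ‖g * f‖_p : g ∈ L^p(G), ‖g‖_p ≤ 1 }`, as an extended real number. -/
noncomputable def normT {G : Type*} [Group G] [MeasurableSpace G] (p : ℝ≥0∞) (μ : Measure G)
    (f : G → ℂ) : ℝ≥0∞ :=
  ⨆ (g : G → ℂ) (_ : MemLp g p μ) (_ : eLpNorm g p μ ≤ 1), eLpNorm (conv μ g f) p μ

/-- The functions in `L^p(G)`. Here and in `LpT`, elements are represented by functions; both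
sets consist of full classes modulo equality almost everywhere. -/
def LpSet {G : Type*} [MeasurableSpace G] (p : ℝ≥0∞) (μ : Measure G) : Set (G → ℂ) :=
  {f | MemLp f p μ}

/-- The set `L^T_p(G)` of all `f ∈ L^p(G)` such that `g * f` exists (as a measurable function)
for all `g ∈ L^p(G)` and `‖f‖_p^T` is finite. -/
def LpT {G : Type*} [Group G] [MeasurableSpace G] (p : ℝ≥0∞) (μ : Measure G) : Set (G → ℂ) :=
  {f | MemLp f p μ ∧
    (∀ g : G → ℂ, MemLp g p μ → ConvExists μ g f ∧ AEStronglyMeasurable (conv μ g f) μ) ∧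
    normT p μ f < ∞}

/-- The norm `|||f|||_p^T = ‖f‖_p + ‖f‖_p^T`. -/
noncomputable def normSumT {G : Type*} [Group G] [MeasurableSpace G] (p : ℝ≥0∞) (μ : Measure G)
    (f : G → ℂ) : ℝ≥0∞ :=
  eLpNorm f p μ + normT p μ f

/-- Two norms are equivalent on the set `S`. -/
def NormsEquivalentOn {G : Type*} (S : Set (G → ℂ)) (N₁ N₂ : (G → ℂ) → ℝ≥0∞) : Prop :=
  ∃ c C : ℝ≥0, 0 < c ∧ 0 < C ∧ ∀ f ∈ S, c * N₁ f ≤ N₂ f ∧ N₂ f ≤ C * N₁ f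

/-- A locally compact group is unimodular if its modular function is identically `1`. -/
def IsUnimodular (G : Type*) [TopologicalSpace G] [Group G] [IsTopologicalGroup G]
    [LocallyCompactSpace G] : Prop :=
  ∀ x : G, Measure.modularCharacter x = 1

end LpTempered

/-! Everything passes through `ConvBound`: an inequality `‖φ * ψ‖_P ≤ C ‖φ‖_P ‖ψ‖_P`, raised to the
power `P`, for nonnegative continuous compactly supported functions. The heart is
`ConvBound.compactSpace`: a locally compact group with such a bound is compact, with no
unimodularity assumption.

Suppose `G` is noncompact. Applied to bumps around compact sets, the bound and Hölder give `μ A * μ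
B ≤ D * μ (A * B)` when `1 ≤ μ B`. So for a large symmetric compact neighbourhood `S` of `1`, the
measures of `S ^ n` at least double at each step, and thin shells carry at least half of the mass.
Put a bump `ψ i` on the `i`-th of a sequence of separated shells, let `M i` be the measure of the
corresponding power of `S`, and set `f = ∑ i < n, (M i) ^ (-1/P) * ψ i`. Then `‖f‖_P ^ P` is at most
a constant times `n`. In `f * f`, the `k + 1` products with `i + j = k` live on one set `W k` whose
measure is at most a constant times `M i * M j`; their masses add, and Hölder on `W k` gives a
contribution of at least `c * (k + 1) ^ P` to the `P`-th power of the norm. Summing over `k < n`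
gives order `n ^ (P + 1)`, while the bound allows only order `n ^ 2`. This is
`not_convBound_of_multiscale`.

The assertions are tied to the bound as follows. If all of `L^p` is tempered, a gliding hump yields
`ConvBound` (`exists_convBound_of_LpSet_subset`). If `μ` is right invariant, Young's inequality
makes continuous compactly supported functions tempered, so a norm estimate on tempered functions is
itself a `ConvBound` (`convBound_of_normT_le`). Conversely, on a compact group Young's inequality
and `‖·‖_1 ≤ c ‖·‖_p` show that every `L^p` function is tempered with a norm estimate
(`exists_normT_le_of_compactSpace`). The equivalence of the two statements about norms is formal.

Since `μ` need not be σ-finite, Fubini is used only for continuous compactly supported integrands;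
general functions are reached through series of these. -/

namespace LpTempered

open Set Filter Topology Pointwise

/-! ### Density, Fubini with compact supports, Hölder and Minkowski inequalities. -/

section General

/-- Continuous functions with compact support are dense in `L^p` for a regular measure on a locally
compact Hausdorff space, which need not be normal. -/
theorem exists_continuous_hasCompactSupport_eLpNorm_sub_le {X : Type*} [TopologicalSpace X]
    [LocallyCompactSpace X] [T2Space X] [MeasurableSpace X] [BorelSpace X] {μ : Measure X}
    [μ.Regular] {p : ℝ≥0∞} (hp : p ≠ ∞) {f : X → ℂ} (hf : MemLp f p μ) {ε : ℝ≥0∞} (hε : ε ≠ 0) :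
    ∃ g : X → ℂ, eLpNorm (f - g) p μ ≤ ε ∧ Continuous g ∧ HasCompactSupport g ∧ MemLp g p μ := by
  apply hf.induction_dense hp _ _ _ _ hε
  rotate_left
  · rintro f g ⟨f_cont, hf, f_mem⟩ ⟨g_cont, hg, g_mem⟩
    exact ⟨f_cont.add g_cont, hf.add hg, f_mem.add g_mem⟩
  · rintro f ⟨_, _, f_mem⟩
    exact f_mem.aestronglyMeasurable
  intro c t ht htμ ε hε
  obtain ⟨δ, δpos, hδ⟩ := exists_Lp_half ℂ μ p hε
  obtain ⟨η, ηpos, hη⟩ := exists_eLpNorm_indicator_le (μ := μ) hp c δpos.ne'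
  have hη' : (0 : ℝ≥0∞) < η := ENNReal.coe_pos.2 ηpos
  -- Replacing `t` by a compact subset makes Urysohn's lemma for a compact set inside an open set
  -- available, which needs only local compactness.
  obtain ⟨s, st, s_compact, s_closed, μs⟩ := ht.exists_isCompact_isClosed_sdiff_lt htμ.ne hη'.ne'
  have hsμ : μ s < ∞ := (measure_mono st).trans_lt htμ
  have I1 : eLpNorm ((s.indicator fun _ => c) - t.indicator fun _ => c) p μ ≤ δ := by
    rw [← eLpNorm_neg, neg_sub, ← indicator_sdiff st]
    exact hη _ μs.le
  obtain ⟨V, sV, V_open, -, hV⟩ := s_closed.measurableSet.exists_isOpen_sdiff_lt hsμ.ne hη'.ne'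
  obtain ⟨g, g_one, g_comp, g_supp, g_range⟩ :=
    exists_continuousMap_one_of_isCompact_subset_isOpen s_compact V_open sV
  have g_cont : Continuous fun x => ((g x : ℝ) : ℂ) * c := by fun_prop
  have g_hcs : HasCompactSupport fun x => ((g x : ℝ) : ℂ) * c :=
    HasCompactSupport.intro g_comp fun x hx => by simp [image_eq_zero_of_notMem_tsupport hx]
  have g_mem := g_cont.memLp_of_hasCompactSupport (p := p) (μ := μ) g_hcs
  have I2 : eLpNorm ((fun x => ((g x : ℝ) : ℂ) * c) - s.indicator fun _ => c) p μ ≤ δ := by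
    refine (eLpNorm_mono fun x => ?_).trans (hη (V \ s) hV.le)
    by_cases hxs : x ∈ s
    · simp [hxs, g_one hxs]
    · by_cases hxV : x ∈ V
      · simp only [Pi.sub_apply, indicator_of_notMem hxs, sub_zero, norm_mul, Complex.norm_real,
          Real.norm_eq_abs, abs_of_nonneg (g_range x).1,
          indicator_of_mem (show x ∈ V \ s from ⟨hxV, hxs⟩)]
        exact mul_le_of_le_one_left (norm_nonneg _) (g_range x).2
      · simp [hxs, image_eq_zero_of_notMem_tsupport (fun h => hxV (g_supp h))]
  refine ⟨_, ?_, g_cont, g_hcs, g_mem⟩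
  have := (hδ _ _ (g_mem.aestronglyMeasurable.sub
    (aestronglyMeasurable_const.indicator s_closed.measurableSet))
    ((aestronglyMeasurable_const.indicator s_closed.measurableSet).sub
    (aestronglyMeasurable_const.indicator ht)) I2 I1).le
  simpa only [sub_add_sub_cancel] using this

/-- The Borel σ-algebra of `X × Y` may exceed the product σ-algebra, but continuous functions with
compact support are measurable for the latter. Restricting `ν` to the compact projection of the
support makes it finite. -/
theorem measurable_lintegral_of_hasCompactSupport {X Y : Type*} [TopologicalSpace X]
    [TopologicalSpace Y] [MeasurableSpace X] [MeasurableSpace Y] [OpensMeasurableSpace X]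
    [OpensMeasurableSpace Y] {F : X × Y → ℝ≥0} (hF : Continuous F) (h'F : HasCompactSupport F)
    (ν : Measure Y) [IsFiniteMeasureOnCompacts ν] :
    Measurable fun x => ∫⁻ y, F (x, y) ∂ν := by
  let V := Prod.snd '' (tsupport F)
  have : Fact (ν V < ∞) := ⟨(IsCompact.image h'F continuous_snd).measure_lt_top⟩
  have h (x : X) : ∫⁻ y, F (x, y) ∂ν = ∫⁻ y in V, F (x, y) ∂ν := by
    refine (setLIntegral_eq_of_support_subset fun y hy => ?_).symm
    exact mem_image_of_mem _ (subset_tsupport _ (show (x, y) ∈ Function.support F by simpa using hy))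
  simp_rw [h]
  exact Measurable.lintegral_prod_right'
    (h'F.stronglyMeasurable_of_prod hF).measurable.coe_nnreal_ennreal

theorem stronglyMeasurable_integral_of_hasCompactSupport {X Y : Type*} [TopologicalSpace X]
    [TopologicalSpace Y] [MeasurableSpace X] [MeasurableSpace Y] [OpensMeasurableSpace X]
    [OpensMeasurableSpace Y] {F : X × Y → ℂ} (hF : Continuous F) (h'F : HasCompactSupport F)
    (ν : Measure Y) [IsFiniteMeasureOnCompacts ν] :
    StronglyMeasurable fun x => ∫ y, F (x, y) ∂ν := by
  let V := Prod.snd '' (tsupport F)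
  have : Fact (ν V < ∞) := ⟨(IsCompact.image h'F continuous_snd).measure_lt_top⟩
  have h (x : X) : ∫ y, F (x, y) ∂ν = ∫ y in V, F (x, y) ∂ν := by
    refine (setIntegral_eq_integral_of_forall_compl_eq_zero fun y hy => ?_).symm
    by_contra h
    exact hy (mem_image_of_mem _ (subset_tsupport _ (show (x, y) ∈ Function.support F from h)))
  simp_rw [h]
  exact StronglyMeasurable.integral_prod_right' (h'F.stronglyMeasurable_of_prod hF)

/-- Both measures can be restricted to the compact projections of the support, where they are finite
and Tonelli applies. -/
theorem lintegral_lintegral_swap_of_hasCompactSupport {X Y : Type*} [TopologicalSpace X]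
    [TopologicalSpace Y] [MeasurableSpace X] [MeasurableSpace Y] [OpensMeasurableSpace X]
    [OpensMeasurableSpace Y] {F : X × Y → ℝ≥0} (hF : Continuous F) (h'F : HasCompactSupport F)
    (μ : Measure X) (ν : Measure Y) [IsFiniteMeasureOnCompacts μ] [IsFiniteMeasureOnCompacts ν] :
    ∫⁻ x, ∫⁻ y, F (x, y) ∂ν ∂μ = ∫⁻ y, ∫⁻ x, F (x, y) ∂μ ∂ν := by
  let U := Prod.fst '' (tsupport F)
  have : Fact (μ U < ∞) := ⟨(IsCompact.image h'F continuous_fst).measure_lt_top⟩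
  let V := Prod.snd '' (tsupport F)
  have : Fact (ν V < ∞) := ⟨(IsCompact.image h'F continuous_snd).measure_lt_top⟩
  have hU {x y} (h : F (x, y) ≠ 0) : x ∈ U := mem_image_of_mem _ (subset_tsupport _ h)
  have hV {x y} (h : F (x, y) ≠ 0) : y ∈ V := mem_image_of_mem _ (subset_tsupport _ h)
  have h1 (x : X) : ∫⁻ y, F (x, y) ∂ν = ∫⁻ y in V, F (x, y) ∂ν :=
    (setLIntegral_eq_of_support_subset fun y hy => hV (x := x) (by simpa using hy)).symm
  have h2 (y : Y) : ∫⁻ x, F (x, y) ∂μ = ∫⁻ x in U, F (x, y) ∂μ :=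
    (setLIntegral_eq_of_support_subset fun x hx => hU (y := y) (by simpa using hx)).symm
  have h3 : ∫⁻ x, ∫⁻ y in V, F (x, y) ∂ν ∂μ = ∫⁻ x in U, ∫⁻ y in V, F (x, y) ∂ν ∂μ := by
    refine (setLIntegral_eq_of_support_subset fun x hx => ?_).symm
    by_contra hxU
    refine hx ?_
    have (y : Y) : F (x, y) = 0 := by_contra fun h => hxU (hU h)
    simp [this]
  have h4 : ∫⁻ y, ∫⁻ x in U, F (x, y) ∂μ ∂ν = ∫⁻ y in V, ∫⁻ x in U, F (x, y) ∂μ ∂ν := by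
    refine (setLIntegral_eq_of_support_subset fun y hy => ?_).symm
    by_contra hyV
    refine hy ?_
    have (x : X) : F (x, y) = 0 := by_contra fun h => hyV (hV h)
    simp [this]
  simp_rw [h1, h2]
  rw [h3, h4]
  exact lintegral_lintegral_swap (f := fun x y => (F (x, y) : ℝ≥0∞))
    (h'F.stronglyMeasurable_of_prod hF).measurable.coe_nnreal_ennreal.aemeasurable

variable {X : Type*} [MeasurableSpace X] {μ : Measure X}

/-- Hölder's inequality with a weight. -/
theorem lintegral_mul_rpow_le {P : ℝ} (hP : 1 < P) {u w : X → ℝ≥0∞} (hu : AEMeasurable u μ)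
    (hw : AEMeasurable w μ) :
    (∫⁻ x, u x * w x ∂μ) ^ P ≤ (∫⁻ x, w x ∂μ) ^ (P - 1) * ∫⁻ x, u x ^ P * w x ∂μ := by
  have hP0 : 0 < P := by linarith
  have hP1 : 0 < P - 1 := by linarith
  have hq : P.HolderConjugate P.conjExponent := Real.HolderConjugate.conjExponent hP
  have hq0 : 0 < P.conjExponent := hq.symm.pos
  have key := ENNReal.lintegral_mul_le_Lp_mul_Lq μ hq
    (f := fun x => u x * w x ^ (1 / P)) (g := fun x => w x ^ (1 / P.conjExponent))
    (hu.mul (hw.pow_const _)) (hw.pow_const _)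
  have e1 : ∀ x, (u x * w x ^ (1 / P)) * w x ^ (1 / P.conjExponent) = u x * w x := fun x => by
    rw [mul_assoc, ← ENNReal.rpow_add_of_nonneg _ _ (by positivity) (by positivity)]
    have : 1 / P + 1 / P.conjExponent = 1 := by simpa [one_div] using hq.inv_add_inv_eq_one
    rw [this, ENNReal.rpow_one]
  have e2 : ∀ x, (u x * w x ^ (1 / P)) ^ P = u x ^ P * w x := fun x => by
    rw [ENNReal.mul_rpow_of_nonneg _ _ hP0.le, ← ENNReal.rpow_mul, one_div_mul_cancel hP0.ne',
      ENNReal.rpow_one]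
  have e3 : ∀ x, (w x ^ (1 / P.conjExponent)) ^ P.conjExponent = w x := fun x => by
    rw [← ENNReal.rpow_mul, one_div_mul_cancel hq0.ne', ENNReal.rpow_one]
  simp only [Pi.mul_apply, e1, e2, e3] at key
  calc _ ≤ _ := ENNReal.rpow_le_rpow key hP0.le
    _ = _ := by
      rw [ENNReal.mul_rpow_of_nonneg _ _ hP0.le, ← ENNReal.rpow_mul, ← ENNReal.rpow_mul,
        one_div_mul_cancel hP0.ne', ENNReal.rpow_one, mul_comm]
      congr 2
      rw [Real.conjExponent]
      field_simp

/-- Weighted Hölder with the indicator of `W` as weight. It is used as a lower bound: mass spread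
over a set of controlled measure forces a large `L^P` norm. -/
theorem lintegral_rpow_le_of_support_subset {P : ℝ} (hP : 1 < P) {u : X → ℝ≥0∞}
    (hu : AEMeasurable u μ) {W : Set X} (hW : MeasurableSet W) (h : Function.support u ⊆ W) :
    (∫⁻ x, u x ∂μ) ^ P ≤ μ W ^ (P - 1) * ∫⁻ x, u x ^ P ∂μ := by
  have key := lintegral_mul_rpow_le (μ := μ) hP hu (w := W.indicator 1)
    (measurable_one.indicator hW).aemeasurable
  have e1 : ∀ x, u x * W.indicator 1 x = u x := fun x => by
    by_cases hx : x ∈ W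
    · simp [hx]
    · have : u x = 0 := by_contra fun h' => hx (h h')
      simp [this]
  have e2 : ∀ x, u x ^ P * W.indicator 1 x = u x ^ P := fun x => by
    by_cases hx : x ∈ W
    · simp [hx]
    · have : u x = 0 := by_contra fun h' => hx (h h')
      simp [this, show 0 < P by linarith]
  simpa only [e1, e2, lintegral_indicator_one hW] using key

/-- Countable subadditivity of the `L^p` norm for nonnegative functions. -/
theorem eLpNorm_tsum_le {p : ℝ≥0∞} (hp : 1 ≤ p) (hp' : p ≠ ∞) {F : ℕ → X → ℝ≥0∞}
    (hF : ∀ n, AEMeasurable (F n) μ) :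
    eLpNorm (fun x => ∑' n, F n x) p μ ≤ ∑' n, eLpNorm (F n) p μ := by
  have hp0 : p ≠ 0 := (zero_lt_one.trans_le hp).ne'
  have hP : 0 < p.toReal := ENNReal.toReal_pos hp0 hp'
  rw [eLpNorm_eq_lintegral_rpow_enorm_toReal hp0 hp', one_div, ENNReal.rpow_inv_le_iff hP]
  simp only [enorm_eq_self]
  have hlim : ∀ x, Tendsto (fun n => (∑ i ∈ Finset.range n, F i x) ^ p.toReal) atTop
      (𝓝 ((∑' n, F n x) ^ p.toReal)) := fun x =>
    (ENNReal.continuous_rpow_const.tendsto _).comp (ENNReal.tendsto_nat_tsum _)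
  have hmeas : ∀ n, AEMeasurable (fun x => (∑ i ∈ Finset.range n, F i x) ^ p.toReal) μ := fun n =>
    (Finset.aemeasurable_fun_sum _ fun i _ => hF i).pow_const _
  refine le_of_tendsto' (lintegral_tendsto_of_tendsto_of_monotone
    hmeas (.of_forall fun x m n hmn => ?_) (.of_forall hlim))
    fun n => ?_
  · exact ENNReal.rpow_le_rpow
      (Finset.sum_le_sum_of_subset (Finset.range_mono hmn)) hP.le
  · have h1 := eLpNorm_sum_le (μ := μ) (p := p) (f := F) (s := Finset.range n)
      (fun i _ => (hF i).aestronglyMeasurable) hp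
    rw [eLpNorm_eq_lintegral_rpow_enorm_toReal hp0 hp', one_div, ENNReal.rpow_inv_le_iff hP] at h1
    simp only [enorm_eq_self, Finset.sum_apply] at h1
    exact h1.trans (ENNReal.rpow_le_rpow (ENNReal.sum_le_tsum _) hP.le)

theorem ae_lt_top_of_eLpNorm_ne_top {p : ℝ≥0∞} (hp : 1 ≤ p) (hp' : p ≠ ∞) {F : X → ℝ≥0∞}
    (hF : AEMeasurable F μ) (h : eLpNorm F p μ ≠ ∞) : ∀ᵐ x ∂μ, F x < ∞ := by
  have hp0 : p ≠ 0 := (zero_lt_one.trans_le hp).ne'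
  have hP : 0 < p.toReal := ENNReal.toReal_pos hp0 hp'
  have h1 : ∫⁻ x, F x ^ p.toReal ∂μ ≠ ∞ := by
    rw [eLpNorm_eq_lintegral_rpow_enorm_toReal hp0 hp'] at h
    simpa [ENNReal.rpow_eq_top_iff, hP, hP.le, not_lt] using h
  filter_upwards [ae_lt_top' (hF.pow_const _) h1] with x hx
  exact (ENNReal.rpow_lt_top_iff_of_pos hP).1 hx

end General

/-! ### Convolution of nonnegative functions and the operator norm. -/

section Convolution

/-- The `L^p` norm of a nonnegative function. -/
noncomputable def nnLpNorm {X : Type*} [MeasurableSpace X] (p : ℝ≥0∞) (μ : Measure X)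
    (φ : X → ℝ≥0) : ℝ≥0∞ :=
  eLpNorm (fun x => (φ x : ℝ≥0∞)) p μ

theorem eLpNorm_rpow_toReal {X : Type*} [MeasurableSpace X] {p : ℝ≥0∞} (hp : 1 < p) (hp' : p < ∞)
    (μ : Measure X) (F : X → ℝ≥0∞) :
    eLpNorm F p μ ^ p.toReal = ∫⁻ x, F x ^ p.toReal ∂μ := by
  have hp0 : p ≠ 0 := (zero_lt_one.trans hp).ne'
  rw [eLpNorm_eq_lintegral_rpow_enorm_toReal hp0 hp'.ne, ← ENNReal.rpow_mul,
    one_div_mul_cancel (ENNReal.toReal_pos hp0 hp'.ne).ne', ENNReal.rpow_one]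
  simp only [enorm_eq_self]

theorem nnLpNorm_lt_top_of_hasCompactSupport {X : Type*} [MeasurableSpace X] [TopologicalSpace X]
    [OpensMeasurableSpace X] {φ : X → ℝ≥0} (hφ : Continuous φ) (h'φ : HasCompactSupport φ)
    (p : ℝ≥0∞) (μ : Measure X) [IsFiniteMeasureOnCompacts μ] : nnLpNorm p μ φ < ∞ := by
  have h : Continuous fun x => (φ x : ℝ) := by fun_prop
  have h' : HasCompactSupport fun x => (φ x : ℝ) := h'φ.comp_left (g := ((↑) : ℝ≥0 → ℝ)) rfl
  refine lt_of_le_of_lt (eLpNorm_mono_enorm fun x => ?_) (h.memLp_of_hasCompactSupport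
    (p := p) (μ := μ) h').2
  simp

theorem lintegral_lt_top_of_hasCompactSupport {X : Type*} [MeasurableSpace X] [TopologicalSpace X]
    [OpensMeasurableSpace X] {φ : X → ℝ≥0} (hφ : Continuous φ) (h'φ : HasCompactSupport φ)
    (μ : Measure X) [IsFiniteMeasureOnCompacts μ] : ∫⁻ x, φ x ∂μ < ∞ := by
  have := nnLpNorm_lt_top_of_hasCompactSupport hφ h'φ 1 μ
  simpa [nnLpNorm, eLpNorm_one_eq_lintegral_enorm] using this

variable {G : Type*} [Group G] [MeasurableSpace G]

/-- The convolution of two nonnegative functions, with values in `[0, ∞]`. -/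
noncomputable def lconv (μ : Measure G) (φ ψ : G → ℝ≥0) (x : G) : ℝ≥0∞ :=
  ∫⁻ y, φ y * ψ (y⁻¹ * x) ∂μ

theorem support_lconv_subset (μ : Measure G) (φ ψ : G → ℝ≥0) :
    Function.support (lconv μ φ ψ) ⊆ Function.support φ * Function.support ψ := by
  intro x hx
  by_contra h
  refine hx ?_
  have (y : G) : (φ y : ℝ≥0∞) * ψ (y⁻¹ * x) = 0 := by
    by_contra h'
    refine h ⟨y, fun h0 => h' (by simp [h0]), y⁻¹ * x, fun h0 => h' (by simp [h0]), by simp⟩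
  simp [lconv, this]

/-- The operator norm controls all functions in `L^p`. -/
theorem eLpNorm_conv_le_normT_mul (p : ℝ≥0∞) (hp : p ≠ 0) (μ : Measure G) (f : G → ℂ)
    {g : G → ℂ} (hg : MemLp g p μ) :
    eLpNorm (conv μ g f) p μ ≤ normT p μ f * eLpNorm g p μ := by
  rcases eq_or_ne (eLpNorm g p μ) 0 with h0 | h0
  · have hg0 : g =ᵐ[μ] 0 := (eLpNorm_eq_zero_iff hg.1 hp).1 h0
    have : conv μ g f = 0 := by
      funext x
      refine integral_eq_zero_of_ae ?_
      filter_upwards [hg0] with y hy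
      simp [hy]
    simp [this]
  · have htop := hg.2.ne
    set a : ℝ := (eLpNorm g p μ).toReal
    have ha : 0 < a := ENNReal.toReal_pos h0 htop
    have hag : ‖((a : ℂ))‖ₑ = eLpNorm g p μ := by
      rw [← ofReal_norm, Complex.norm_real, Real.norm_of_nonneg ha.le,
        ENNReal.ofReal_toReal htop]
    have hgs : g = (a : ℂ) • ((a : ℂ)⁻¹ • g) := by
      rw [smul_smul, mul_inv_cancel₀ (by exact_mod_cast ha.ne'), one_smul]
    have h1 : eLpNorm ((a : ℂ)⁻¹ • g) p μ ≤ 1 := by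
      rw [eLpNorm_const_smul, enorm_inv (by exact_mod_cast ha.ne'), hag,
        ENNReal.inv_mul_cancel h0 htop]
    have h2 : eLpNorm (conv μ ((a : ℂ)⁻¹ • g) f) p μ ≤ normT p μ f :=
      le_iSup₂_of_le _ (hg.const_smul _) (le_iSup_of_le h1 le_rfl)
    have h3 : conv μ g f = (a : ℂ) • conv μ ((a : ℂ)⁻¹ • g) f := by
      funext x
      conv_lhs => rw [hgs]
      simp only [conv, Pi.smul_apply, smul_eq_mul, ← integral_const_mul, mul_assoc]
    rw [h3, eLpNorm_const_smul, hag, mul_comm]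
    gcongr

end Convolution

/-! ### Mass and `L^P` estimates for convolutions of compactly supported functions. -/

section TopologicalConvolution

variable {G : Type*} [Group G] [TopologicalSpace G] [IsTopologicalGroup G] {φ ψ : G → ℝ≥0}

theorem continuous_mul_inv_mul {R : Type*} [Semiring R] [TopologicalSpace R]
    [IsTopologicalSemiring R] {φ ψ : G → R} (hφ : Continuous φ) (hψ : Continuous ψ) :
    Continuous fun z : G × G => φ z.2 * ψ (z.2⁻¹ * z.1) := by
  fun_prop

theorem hasCompactSupport_mul_inv_mul {R : Type*} [Semiring R] {φ ψ : G → R}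
    (h'φ : HasCompactSupport φ)
    (h'ψ : HasCompactSupport ψ) :
    HasCompactSupport fun z : G × G => φ z.2 * ψ (z.2⁻¹ * z.1) := by
  refine HasCompactSupport.intro ((h'φ.isCompact.mul h'ψ.isCompact).prod h'φ.isCompact) ?_
  rintro ⟨x, y⟩ hxy
  by_contra h
  have h1 : φ y ≠ 0 := fun h0 => h (by simp [h0])
  have h2 : ψ (y⁻¹ * x) ≠ 0 := fun h0 => h (by simp [h0])
  exact hxy ⟨⟨y, subset_tsupport _ h1, y⁻¹ * x, subset_tsupport _ h2, by simp⟩,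
    subset_tsupport _ h1⟩

variable [MeasurableSpace G] [BorelSpace G] {μ : Measure G}

theorem measurable_lconv [IsFiniteMeasureOnCompacts μ] (hφ : Continuous φ)
    (hψ : Continuous ψ) (h'φ : HasCompactSupport φ) (h'ψ : HasCompactSupport ψ) :
    Measurable (lconv μ φ ψ) := by
  have := measurable_lintegral_of_hasCompactSupport (continuous_mul_inv_mul hφ hψ)
    (hasCompactSupport_mul_inv_mul h'φ h'ψ) μ
  simp only [ENNReal.coe_mul] at this
  exact this

theorem lintegral_lconv [IsFiniteMeasureOnCompacts μ] [μ.IsMulLeftInvariant]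
    (hφ : Continuous φ) (hψ : Continuous ψ) (h'φ : HasCompactSupport φ)
    (h'ψ : HasCompactSupport ψ) :
    ∫⁻ x, lconv μ φ ψ x ∂μ = (∫⁻ x, φ x ∂μ) * ∫⁻ x, ψ x ∂μ := by
  have := lintegral_lintegral_swap_of_hasCompactSupport (continuous_mul_inv_mul hφ hψ)
    (hasCompactSupport_mul_inv_mul h'φ h'ψ) μ μ
  simp only [ENNReal.coe_mul] at this
  simp only [lconv]
  rw [this, ← lintegral_mul_const _ hφ.measurable.coe_nnreal_ennreal]
  congr 1 with y
  rw [lintegral_const_mul _ (by fun_prop), lintegral_mul_left_eq_self (fun x => (ψ x : ℝ≥0∞)) y⁻¹]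

/-- After the substitution `y ↦ x * y` the convolution averages right translates of `φ` against the
weight `ψ y⁻¹`. Weighted Hölder, an exchange of integrals and right invariance finish the estimate.
-/
theorem lintegral_rpow_lconv_le [IsFiniteMeasureOnCompacts μ] [μ.IsMulLeftInvariant]
    [μ.IsMulRightInvariant] {P : ℝ} (hP : 1 < P)
    (hφ : Continuous φ) (hψ : Continuous ψ) (h'φ : HasCompactSupport φ)
    (h'ψ : HasCompactSupport ψ) :
    ∫⁻ x, lconv μ φ ψ x ^ P ∂μ ≤ (∫⁻ x, ψ x⁻¹ ∂μ) ^ P * ∫⁻ x, (φ x : ℝ≥0∞) ^ P ∂μ := by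
  have hP0 : 0 < P := by linarith
  set I := ∫⁻ x, ψ x⁻¹ ∂μ with hI
  have e (x : G) : lconv μ φ ψ x = ∫⁻ y, (φ (x * y) : ℝ≥0∞) * ψ y⁻¹ ∂μ := by
    rw [lconv, ← lintegral_mul_left_eq_self _ x]
    simp [mul_assoc]
  have hI' : I ≠ ∞ := by
    have hc : HasCompactSupport fun x => ψ x⁻¹ := h'ψ.comp_homeomorph (Homeomorph.inv G)
    exact (lintegral_lt_top_of_hasCompactSupport (hψ.comp continuous_inv) hc μ).ne
  have h1 (x : G) : lconv μ φ ψ x ^ P ≤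
      I ^ (P - 1) * ∫⁻ y, (φ (x * y) : ℝ≥0∞) ^ P * ψ y⁻¹ ∂μ := by
    rw [e]
    exact lintegral_mul_rpow_le hP (by fun_prop) (by fun_prop)
  have hc1 : Continuous fun z : G × G => φ (z.1 * z.2) ^ P * ψ z.2⁻¹ := by
    refine Continuous.mul ?_ (by fun_prop)
    exact (NNReal.continuous_rpow_const hP0.le).comp (by fun_prop)
  have hc2 : HasCompactSupport fun z : G × G => φ (z.1 * z.2) ^ P * ψ z.2⁻¹ := by
    refine HasCompactSupport.intro
      ((h'φ.isCompact.mul h'ψ.isCompact).prod h'ψ.isCompact.inv) ?_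
    rintro ⟨x, y⟩ hxy
    by_contra h
    have h1 : φ (x * y) ≠ 0 := fun h0 => h (by simp [h0, hP0.ne'])
    have h2 : ψ y⁻¹ ≠ 0 := fun h0 => h (by simp [h0])
    exact hxy ⟨⟨x * y, subset_tsupport _ h1, y⁻¹, subset_tsupport _ h2, by simp⟩,
      by simpa using subset_tsupport _ h2⟩
  have swap := lintegral_lintegral_swap_of_hasCompactSupport hc1 hc2 μ μ
  simp only [ENNReal.coe_mul, ENNReal.coe_rpow_of_nonneg _ hP0.le] at swap
  calc ∫⁻ x, lconv μ φ ψ x ^ P ∂μ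
      ≤ ∫⁻ x, I ^ (P - 1) * ∫⁻ y, (φ (x * y) : ℝ≥0∞) ^ P * ψ y⁻¹ ∂μ ∂μ := lintegral_mono h1
    _ = I ^ (P - 1) * ∫⁻ x, ∫⁻ y, (φ (x * y) : ℝ≥0∞) ^ P * ψ y⁻¹ ∂μ ∂μ :=
      lintegral_const_mul' _ _ (ENNReal.rpow_ne_top_of_nonneg (by linarith) hI')
    _ = I ^ (P - 1) * ∫⁻ y, (∫⁻ x, (φ x : ℝ≥0∞) ^ P ∂μ) * ψ y⁻¹ ∂μ := by
      rw [swap]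
      congr 2 with y
      rw [lintegral_mul_const _ (by fun_prop),
        lintegral_mul_right_eq_self (fun x => (φ x : ℝ≥0∞) ^ P) y]
    _ = _ := by
      rw [lintegral_const_mul _ (by fun_prop), ← hI, mul_comm (∫⁻ x, _ ∂μ), ← mul_assoc]
      congr 1
      nth_rewrite 2 [← ENNReal.rpow_one I]
      rw [← ENNReal.rpow_add_of_nonneg _ _ (by linarith) zero_le_one]
      simp

end TopologicalConvolution

/-! ### The multi-scale obstruction to the convolution inequality. -/

section MultiScale

/-- Superadditivity of `P`-th powers lets the scales of the convolution square be estimated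
separately even if their supports overlap. -/
theorem sum_rpow_le_rpow_sum {ι : Type*} {P : ℝ} (hP : 1 ≤ P) (s : Finset ι) (h : ι → ℝ≥0∞) :
    ∑ i ∈ s, h i ^ P ≤ (∑ i ∈ s, h i) ^ P := by
  classical
  induction s using Finset.induction_on with
  | empty => simp
  | insert i s hi ih =>
    rw [Finset.sum_insert hi, Finset.sum_insert hi]
    exact (add_le_add le_rfl ih).trans (ENNReal.add_rpow_le_rpow_add _ _ hP)

theorem sum_antidiagonal_le_sum_product (n : ℕ) (F : ℕ × ℕ → ℝ≥0∞) :
    ∑ k ∈ Finset.range n, ∑ z ∈ Finset.HasAntidiagonal.antidiagonal k, F z ≤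
      ∑ i ∈ Finset.range n, ∑ j ∈ Finset.range n, F (i, j) := by
  rw [← Finset.sum_product', ← Finset.sum_biUnion]
  · refine Finset.sum_le_sum_of_subset fun z hz => ?_
    simp only [Finset.mem_biUnion, Finset.mem_range, Finset.HasAntidiagonal.mem_antidiagonal] at hz
    simp only [Finset.mem_product, Finset.mem_range]
    lia
  · intro k _ l _ hkl
    refine Finset.disjoint_left.2 fun z hz hz' => hkl ?_
    rw [← Finset.HasAntidiagonal.mem_antidiagonal.1 hz,
      ← Finset.HasAntidiagonal.mem_antidiagonal.1 hz']

/-- The upper half of a sum of length `2 * n` is already at least `n ^ (P + 1)`, so the inequality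
would bound `n ^ (P - 1)` by `4 * B / c` for every positive `n`. -/
theorem not_forall_mul_sum_rpow_le {P : ℝ} (hP : 1 < P) {c B : ℝ≥0∞} (hc : c ≠ 0) (hB : B ≠ ∞) :
    ¬ ∀ n : ℕ, 0 < n → c * ∑ k ∈ Finset.range n, ((k : ℝ≥0∞) + 1) ^ P ≤ B * (n : ℝ≥0∞) ^ 2 := by
  intro H
  have h1 (n : ℕ) (hn : 0 < n) : (n : ℝ≥0∞) ^ (P - 1) ≤ B * 4 / c := by
    have hn0 : (n : ℝ≥0∞) ≠ 0 := by exact_mod_cast hn.ne'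
    have hnt : (n : ℝ≥0∞) ≠ ∞ := ENNReal.natCast_ne_top n
    have h2 : (n : ℝ≥0∞) * (n : ℝ≥0∞) ^ P ≤
        ∑ k ∈ Finset.range (2 * n), ((k : ℝ≥0∞) + 1) ^ P := by
      calc (n : ℝ≥0∞) * (n : ℝ≥0∞) ^ P = ∑ k ∈ Finset.Ico n (2 * n), (n : ℝ≥0∞) ^ P := by
            simp [two_mul]
        _ ≤ ∑ k ∈ Finset.Ico n (2 * n), ((k : ℝ≥0∞) + 1) ^ P := by
            refine Finset.sum_le_sum fun k hk => ENNReal.rpow_le_rpow ?_ (by linarith)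
            have := (Finset.mem_Ico.1 hk).1
            exact_mod_cast this.trans (Nat.le_succ k)
        _ ≤ _ := Finset.sum_le_sum_of_subset fun k hk => by
            simp only [Finset.mem_Ico, Finset.mem_range] at hk ⊢
            exact hk.2
    have h3 := (mul_le_mul_right h2 c).trans (H (2 * n) (by lia))
    have h4 : (n : ℝ≥0∞) * (n : ℝ≥0∞) ^ P = (n : ℝ≥0∞) ^ (P - 1) * (n : ℝ≥0∞) ^ 2 := by
      conv_lhs => rw [← ENNReal.rpow_one (n : ℝ≥0∞)]
      rw [← ENNReal.rpow_mul, ← ENNReal.rpow_natCast, ← ENNReal.rpow_add _ _ hn0 hnt,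
        ← ENNReal.rpow_add _ _ hn0 hnt]
      congr 1
      push_cast
      ring
    rw [h4, ← mul_assoc] at h3
    have h5 : B * ((2 * n : ℕ) : ℝ≥0∞) ^ 2 = (B * 4) * (n : ℝ≥0∞) ^ 2 := by
      push_cast
      ring
    rw [h5, ENNReal.mul_le_mul_iff_left (pow_ne_zero _ hn0) (ENNReal.pow_ne_top hnt)] at h3
    rw [ENNReal.le_div_iff_mul_le (.inl hc) (.inr (ENNReal.mul_ne_top hB (by simp))), mul_comm]
    exact h3
  have hr : B * 4 / c ≠ ∞ := ENNReal.div_ne_top (ENNReal.mul_ne_top hB (by simp)) hc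
  obtain ⟨n, hn1, hn2⟩ := ((((tendsto_rpow_atTop (sub_pos.2 hP)).comp
    tendsto_natCast_atTop_atTop).eventually_gt_atTop (B * 4 / c).toReal).and
    (eventually_gt_atTop 0)).exists
  refine absurd (h1 n hn2) (not_le.2 ?_)
  rw [← ENNReal.toReal_lt_toReal hr (ENNReal.rpow_ne_top_of_nonneg (sub_pos.2 hP).le
    (ENNReal.natCast_ne_top n)), ← ENNReal.toReal_rpow]
  simpa using hn1

variable {G : Type*} [Group G] [TopologicalSpace G] [IsTopologicalGroup G]
  [MeasurableSpace G] [BorelSpace G] {μ : Measure G}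

/-- The convolution inequality `‖φ * ψ‖ ≤ C ‖φ‖ ‖ψ‖` in `L^P`, in terms of `P`-th powers, for those
continuous `ψ` that are bounded by `1` and whose norm is not too small. -/
def ConvBound (μ : Measure G) (P : ℝ) (C : ℝ≥0∞) : Prop :=
  ∀ φ ψ : G → ℝ≥0, Continuous φ → HasCompactSupport φ → Continuous ψ → HasCompactSupport ψ →
    (∀ x, ψ x ≤ 1) → 1 ≤ 2 * ∫⁻ x, (ψ x : ℝ≥0∞) ^ P ∂μ →
    ∫⁻ x, lconv μ φ ψ x ^ P ∂μ ≤
      C * (∫⁻ x, (φ x : ℝ≥0∞) ^ P ∂μ) * ∫⁻ x, (ψ x : ℝ≥0∞) ^ P ∂μ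

theorem rpow_sum_of_pairwise_eq_zero {P : ℝ} (hP : 0 < P) (b : ℕ → ℝ≥0) (s : Finset ℕ)
    (hb : ∀ i j, i ≠ j → b i = 0 ∨ b j = 0) :
    (∑ i ∈ s, b i) ^ P = ∑ i ∈ s, b i ^ P := by
  by_cases h : ∃ i ∈ s, b i ≠ 0
  · obtain ⟨i, his, hi⟩ := h
    have h0 (j : ℕ) (hj : j ≠ i) : b j = 0 := (hb j i hj).resolve_right hi
    rw [Finset.sum_eq_single i (fun j _ hj => h0 j hj) (fun h => absurd his h),
      Finset.sum_eq_single i (fun j _ hj => by simp [h0 j hj, hP.ne']) (fun h => absurd his h)]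
  · push Not at h
    rw [Finset.sum_eq_zero h, Finset.sum_eq_zero fun i hi => by simp [h i hi, hP.ne']]
    simp [hP.ne']

theorem lconv_sum_sum (ψ : ℕ → G → ℝ≥0) (hψ : ∀ i, Continuous (ψ i)) (a : ℕ → ℝ≥0)
    (s : Finset ℕ) (x : G) :
    lconv μ (fun y => ∑ i ∈ s, a i * ψ i y) (fun y => ∑ i ∈ s, a i * ψ i y) x =
      ∑ i ∈ s, ∑ j ∈ s, a i * a j * lconv μ (ψ i) (ψ j) x := by
  have hm (i j : ℕ) : Measurable fun y => (ψ i y : ℝ≥0∞) * ψ j (y⁻¹ * x) := by fun_prop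
  simp only [lconv]
  have e (i j : ℕ) : (a i : ℝ≥0∞) * a j * ∫⁻ y, ψ i y * ψ j (y⁻¹ * x) ∂μ =
      ∫⁻ y, (a i : ℝ≥0∞) * a j * (ψ i y * ψ j (y⁻¹ * x)) ∂μ :=
    (lintegral_const_mul _ (hm i j)).symm
  simp_rw [e]
  have e2 (i : ℕ) : ∑ j ∈ s, ∫⁻ y, (a i : ℝ≥0∞) * a j * (ψ i y * ψ j (y⁻¹ * x)) ∂μ =
      ∫⁻ y, ∑ j ∈ s, (a i : ℝ≥0∞) * a j * (ψ i y * ψ j (y⁻¹ * x)) ∂μ :=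
    (lintegral_finsetSum _ fun j _ => (hm i j).const_mul _).symm
  simp_rw [e2]
  rw [← lintegral_finsetSum _ fun i _ => Finset.measurable_sum _ fun j _ => (hm i j).const_mul _]
  congr 1 with y
  push_cast
  rw [Finset.sum_mul_sum]
  refine Finset.sum_congr rfl fun i _ => Finset.sum_congr rfl fun j _ => ?_
  ring

/-- A multi-scale family of test functions contradicts the convolution inequality. -/
theorem not_convBound_of_multiscale [IsFiniteMeasureOnCompacts μ] [μ.IsMulLeftInvariant]
    {P : ℝ} (hP : 1 < P) {C m E : ℝ≥0∞} (hC : C ≠ ∞) (hm : m ≠ ∞) (hE : E ≠ ∞)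
    (ψ : ℕ → G → ℝ≥0) (M : ℕ → ℝ≥0) (W : ℕ → Set G)
    (hψ : ∀ i, Continuous (ψ i)) (h'ψ : ∀ i, HasCompactSupport (ψ i)) (hM : ∀ i, 1 ≤ M i)
    (hdisj : ∀ i j, i ≠ j → ∀ x, ψ i x = 0 ∨ ψ j x = 0) (hle : ∀ i x, ψ i x ≤ 1)
    (hlow : ∀ i, (M i : ℝ≥0∞) ≤ 2 * ∫⁻ x, (ψ i x : ℝ≥0∞) ∂μ)
    (hlow' : ∀ i, (M i : ℝ≥0∞) ≤ 2 * ∫⁻ x, (ψ i x : ℝ≥0∞) ^ P ∂μ)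
    (hup : ∀ i, ∫⁻ x, (ψ i x : ℝ≥0∞) ^ P ∂μ ≤ m * M i)
    (hW : ∀ k, MeasurableSet (W k)) (hW0 : ∀ k, μ (W k) ≠ 0)
    (hsupp : ∀ i j, Function.support (ψ i) * Function.support (ψ j) ⊆ W (i + j))
    (hWM : ∀ i j, μ (W (i + j)) ≤ E * (M i * M j)) :
    ¬ ConvBound μ P C := by
  intro H
  have hP0 : 0 < P := by linarith
  have hP1 : 0 < P - 1 := by linarith
  have hM0 (i : ℕ) : M i ≠ 0 := (zero_lt_one.trans_le (hM i)).ne'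
  -- This normalisation puts the `P`-th power of the norm of `a i * ψ i` between `1 / 2` and `m`.
  set a : ℕ → ℝ≥0 := fun i => M i ^ (-(1 / P)) with ha
  have haP (i : ℕ) : (a i : ℝ≥0∞) ^ P = (M i : ℝ≥0∞)⁻¹ := by
    rw [← ENNReal.coe_rpow_of_nonneg _ hP0.le, ha, ← NNReal.rpow_mul, neg_mul,
      one_div_mul_cancel hP0.ne', NNReal.rpow_neg_one, ENNReal.coe_inv (hM0 i)]
  have ha1 (i : ℕ) : a i ≤ 1 :=
    NNReal.rpow_le_one_of_one_le_of_nonpos (hM i) (by simp [hP0.le])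
  have hWt (k : ℕ) : μ (W k) ≠ ∞ :=
    ne_top_of_le_ne_top (ENNReal.mul_ne_top hE (ENNReal.mul_ne_top ENNReal.coe_ne_top
      ENNReal.coe_ne_top)) (by simpa only [zero_add] using hWM 0 k)
  have hE0 : E ≠ 0 := by
    rintro rfl
    exact hW0 _ (le_antisymm (by simpa using hWM 0 0) bot_le)
  -- The `4` comes from the factor `2` in `hlow`, used for both functions of a product; `E ^ (P -
  -- 1)` comes from comparing `M i * M j` with `μ (W (i + j))`.
  set c : ℝ≥0∞ := (4 ^ P * E ^ (P - 1))⁻¹ with hc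
  have hc0 : c ≠ 0 := by
    rw [hc, ENNReal.inv_ne_zero]
    exact ENNReal.mul_ne_top (ENNReal.rpow_ne_top_of_nonneg hP0.le (by simp))
      (ENNReal.rpow_ne_top_of_nonneg hP1.le hE)
  -- the part of the convolution square at scale `k`
  set h : ℕ → G → ℝ≥0∞ := fun k x =>
    ∑ z ∈ Finset.HasAntidiagonal.antidiagonal k,
      (a z.1 : ℝ≥0∞) * a z.2 * lconv μ (ψ z.1) (ψ z.2) x with hh
  have hmeas (i j : ℕ) : Measurable (lconv μ (ψ i) (ψ j)) :=
    measurable_lconv (hψ i) (hψ j) (h'ψ i) (h'ψ j)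
  have hhm (k : ℕ) : Measurable (h k) :=
    Finset.measurable_sum _ fun z _ => (hmeas z.1 z.2).const_mul _
  have hhs (k : ℕ) : Function.support (h k) ⊆ W k := by
    intro x hx
    obtain ⟨z, hz, hzx⟩ := Finset.exists_ne_zero_of_sum_ne_zero hx
    rw [← Finset.HasAntidiagonal.mem_antidiagonal.1 hz]
    exact hsupp _ _ (support_lconv_subset μ _ _ (right_ne_zero_of_mul hzx))
  have hterm (i j : ℕ) : (μ (W (i + j)) / E) ^ (1 - 1 / P) ≤
      4 * ((a i : ℝ≥0∞) * a j * ((∫⁻ x, ψ i x ∂μ) * ∫⁻ x, ψ j x ∂μ)) := by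
    have e (i : ℕ) : (M i : ℝ≥0∞) ^ (1 - 1 / P) = a i * M i := by
      rw [ha, ← ENNReal.coe_rpow_of_ne_zero (hM0 i), ← ENNReal.coe_mul]
      congr 1
      dsimp only
      nth_rewrite 3 [← NNReal.rpow_one (M i)]
      rw [← NNReal.rpow_add (hM0 i)]
      congr 1
      ring
    have h1P : 0 ≤ 1 - 1 / P := by
      rw [sub_nonneg, div_le_one hP0]
      exact hP.le
    calc (μ (W (i + j)) / E) ^ (1 - 1 / P) ≤ ((M i : ℝ≥0∞) * M j) ^ (1 - 1 / P) := by
          refine ENNReal.rpow_le_rpow ?_ h1P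
          exact ENNReal.div_le_of_le_mul' (hWM i j)
      _ = (a i * M i) * (a j * M j) := by
          rw [ENNReal.mul_rpow_of_nonneg _ _ h1P, e, e]
      _ ≤ (a i * (2 * ∫⁻ x, ψ i x ∂μ)) * (a j * (2 * ∫⁻ x, ψ j x ∂μ)) := by
          gcongr
          · exact hlow i
          · exact hlow j
      _ = _ := by ring
  -- The gain is the factor `k + 1`: every pair with `i + j = k` contributes at least the same mass,
  -- on the same set `W k`.
  have hint (k : ℕ) : ((k : ℝ≥0∞) + 1) * (μ (W k) / E) ^ (1 - 1 / P) ≤ 4 * ∫⁻ x, h k x ∂μ := by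
    have e1 : ∫⁻ x, h k x ∂μ = ∑ z ∈ Finset.HasAntidiagonal.antidiagonal k,
        (a z.1 : ℝ≥0∞) * a z.2 * ((∫⁻ x, ψ z.1 x ∂μ) * ∫⁻ x, ψ z.2 x ∂μ) := by
      rw [lintegral_finsetSum _ fun z _ => (hmeas z.1 z.2).const_mul _]
      refine Finset.sum_congr rfl fun z _ => ?_
      rw [lintegral_const_mul _ (hmeas z.1 z.2),
        lintegral_lconv (hψ _) (hψ _) (h'ψ _) (h'ψ _)]
    rw [e1, Finset.mul_sum]
    calc _ = ∑ z ∈ Finset.HasAntidiagonal.antidiagonal k, (μ (W k) / E) ^ (1 - 1 / P) := by simp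
      _ ≤ _ := Finset.sum_le_sum fun z hz => by
        rw [← Finset.HasAntidiagonal.mem_antidiagonal.1 hz]
        exact hterm z.1 z.2
  have hpow (k : ℕ) : c * ((k : ℝ≥0∞) + 1) ^ P ≤ ∫⁻ x, h k x ^ P ∂μ := by
    have h1 := ENNReal.rpow_le_rpow (hint k) hP0.le
    rw [ENNReal.mul_rpow_of_nonneg _ _ hP0.le, ENNReal.mul_rpow_of_nonneg _ _ hP0.le,
      ← ENNReal.rpow_mul, sub_mul, one_mul, one_div_mul_cancel hP0.ne',
      ENNReal.div_rpow_of_nonneg _ _ hP1.le] at h1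
    have h2 := h1.trans (mul_le_mul_right
      (lintegral_rpow_le_of_support_subset hP (hhm k).aemeasurable (hW k) (hhs k)) _)
    have hw0 : μ (W k) ^ (P - 1) ≠ 0 := by simp [ENNReal.rpow_eq_zero_iff, hW0, hWt]
    have hwt : μ (W k) ^ (P - 1) ≠ ∞ := ENNReal.rpow_ne_top_of_nonneg hP1.le (hWt k)
    have he0 : E ^ (P - 1) ≠ 0 := by simp [ENNReal.rpow_eq_zero_iff, hE0, hE]
    have het : E ^ (P - 1) ≠ ∞ := ENNReal.rpow_ne_top_of_nonneg hP1.le hE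
    have h40 : (4 : ℝ≥0∞) ^ P ≠ 0 := by simp [ENNReal.rpow_eq_zero_iff]
    have h4t : (4 : ℝ≥0∞) ^ P ≠ ∞ := ENNReal.rpow_ne_top_of_nonneg hP0.le (by simp)
    rw [hc, ENNReal.inv_mul_le_iff (mul_ne_zero h40 he0) (ENNReal.mul_ne_top h4t het)]
    rw [← ENNReal.mul_le_mul_iff_left hw0 hwt]
    calc ((k : ℝ≥0∞) + 1) ^ P * μ (W k) ^ (P - 1)
        = E ^ (P - 1) * (((k : ℝ≥0∞) + 1) ^ P * (μ (W k) ^ (P - 1) / E ^ (P - 1))) := by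
          rw [mul_left_comm, ENNReal.mul_div_cancel he0 het]
      _ ≤ E ^ (P - 1) * (4 ^ P * (μ (W k) ^ (P - 1) * ∫⁻ x, h k x ^ P ∂μ)) := by gcongr
      _ = _ := by ring
  refine not_forall_mul_sum_rpow_le hP hc0 (B := C * m ^ 2)
    (ENNReal.mul_ne_top hC (ENNReal.pow_ne_top hm)) fun n hn => ?_
  set f : G → ℝ≥0 := fun x => ∑ i ∈ Finset.range n, a i * ψ i x with hf
  have hfc : Continuous f := by fun_prop
  have hfs : HasCompactSupport f := by
    have := HasCompactSupport.intro
      (K := ⋃ i ∈ Finset.range n, tsupport (ψ i)) (f := f)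
      ((Finset.range n).isCompact_biUnion fun i _ => (h'ψ i).isCompact) fun x hx => ?_
    · exact this
    · refine Finset.sum_eq_zero fun i hi => ?_
      rw [image_eq_zero_of_notMem_tsupport fun h => hx (mem_biUnion hi h), mul_zero]
  have hfP (x : G) : (f x : ℝ≥0∞) ^ P =
      ∑ i ∈ Finset.range n, (M i : ℝ≥0∞)⁻¹ * (ψ i x : ℝ≥0∞) ^ P := by
    rw [← ENNReal.coe_rpow_of_nonneg _ hP0.le, hf,
      rpow_sum_of_pairwise_eq_zero hP0 (fun i => a i * ψ i x)
        (hb := fun i j hij => (hdisj i j hij x).imp (by simp +contextual) (by simp +contextual))]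
    push_cast
    refine Finset.sum_congr rfl fun i _ => ?_
    rw [ENNReal.coe_rpow_of_nonneg _ hP0.le, ENNReal.coe_mul,
      ENNReal.mul_rpow_of_nonneg _ _ hP0.le, haP]
  have hf1 (x : G) : f x ≤ 1 := by
    rw [hf]
    by_cases hx : ∃ i ∈ Finset.range n, ψ i x ≠ 0
    · obtain ⟨i, hin, hi⟩ := hx
      have h0 (j : ℕ) (hj : j ≠ i) : ψ j x = 0 := (hdisj j i hj x).resolve_right hi
      dsimp only
      rw [Finset.sum_eq_single i (fun j _ hj => by simp [h0 j hj]) (fun h => absurd hin h)]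
      exact mul_le_one' (ha1 i) (hle i x)
    · push Not at hx
      dsimp only
      rw [Finset.sum_eq_zero fun i hi => by simp [hx i hi]]
      exact zero_le_one
  have hψm (i : ℕ) : Measurable fun x => (ψ i x : ℝ≥0∞) ^ P :=
    (hψ i).measurable.coe_nnreal_ennreal.pow_const P
  have hfint : ∫⁻ x, (f x : ℝ≥0∞) ^ P ∂μ =
      ∑ i ∈ Finset.range n, (M i : ℝ≥0∞)⁻¹ * ∫⁻ x, (ψ i x : ℝ≥0∞) ^ P ∂μ := by
    simp_rw [hfP]
    rw [lintegral_finsetSum _ fun i _ => (hψm i).const_mul _]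
    exact Finset.sum_congr rfl fun i _ => lintegral_const_mul _ (hψm i)
  have hMe0 (i : ℕ) : (M i : ℝ≥0∞) ≠ 0 := by exact_mod_cast hM0 i
  have hfup : ∫⁻ x, (f x : ℝ≥0∞) ^ P ∂μ ≤ m * n := by
    rw [hfint]
    calc _ ≤ ∑ i ∈ Finset.range n, m := Finset.sum_le_sum fun i _ => by
          rw [ENNReal.inv_mul_le_iff (hMe0 i) ENNReal.coe_ne_top, mul_comm]
          exact hup i
      _ = m * n := by simp [mul_comm]
  -- The term at scale `0` alone makes `f` admissible as second factor in `ConvBound`.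
  have hflow : 1 ≤ 2 * ∫⁻ x, (f x : ℝ≥0∞) ^ P ∂μ := by
    have h1 : (M 0 : ℝ≥0∞)⁻¹ * ∫⁻ x, (ψ 0 x : ℝ≥0∞) ^ P ∂μ ≤ ∫⁻ x, (f x : ℝ≥0∞) ^ P ∂μ := by
      rw [hfint]
      exact Finset.single_le_sum (f := fun i => (M i : ℝ≥0∞)⁻¹ * ∫⁻ x, (ψ i x : ℝ≥0∞) ^ P ∂μ)
        (fun i _ => bot_le) (Finset.mem_range.2 hn)
    calc (1 : ℝ≥0∞) = (M 0 : ℝ≥0∞)⁻¹ * M 0 := (ENNReal.inv_mul_cancel (hMe0 0) (by simp)).symm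
      _ ≤ (M 0 : ℝ≥0∞)⁻¹ * (2 * ∫⁻ x, (ψ 0 x : ℝ≥0∞) ^ P ∂μ) := by gcongr; exact hlow' 0
      _ = 2 * ((M 0 : ℝ≥0∞)⁻¹ * ∫⁻ x, (ψ 0 x : ℝ≥0∞) ^ P ∂μ) := by ring
      _ ≤ _ := by gcongr
  calc c * ∑ k ∈ Finset.range n, ((k : ℝ≥0∞) + 1) ^ P
      ≤ ∑ k ∈ Finset.range n, ∫⁻ x, h k x ^ P ∂μ := by
        rw [Finset.mul_sum]
        exact Finset.sum_le_sum fun k _ => hpow k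
    _ = ∫⁻ x, ∑ k ∈ Finset.range n, h k x ^ P ∂μ :=
        (lintegral_finsetSum _ fun k _ => (hhm k).pow_const P).symm
    _ ≤ ∫⁻ x, lconv μ f f x ^ P ∂μ := by
        refine lintegral_mono fun x => (sum_rpow_le_rpow_sum hP.le _ _).trans ?_
        refine ENNReal.rpow_le_rpow ?_ hP0.le
        rw [hf, lconv_sum_sum ψ hψ]
        exact sum_antidiagonal_le_sum_product n
          fun z => (a z.1 : ℝ≥0∞) * a z.2 * lconv μ (ψ z.1) (ψ z.2) x
    _ ≤ C * (∫⁻ x, (f x : ℝ≥0∞) ^ P ∂μ) * ∫⁻ x, (f x : ℝ≥0∞) ^ P ∂μ :=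
        H f f hfc hfs hfc hfs hf1 hflow
    _ ≤ C * (m * n) * (m * n) := by gcongr
    _ = _ := by ring

end MultiScale

/-! ### Bump functions adapted to compact sets. -/

section Bump

theorem exists_nnreal_bump {X : Type*} [TopologicalSpace X] [T2Space X] [LocallyCompactSpace X]
    {K V : Set X} (hK : IsCompact K)
    (hV : IsOpen V) (hKV : K ⊆ V) :
    ∃ φ : X → ℝ≥0, Continuous φ ∧ HasCompactSupport φ ∧ (∀ x, φ x ≤ 1) ∧ (∀ x ∈ K, φ x = 1) ∧
      Function.support φ ⊆ V := by
  obtain ⟨f, f_one, f_comp, f_supp, f_range⟩ :=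
    exists_continuousMap_one_of_isCompact_subset_isOpen hK hV hKV
  refine ⟨fun x => (f x).toNNReal, by fun_prop, ?_, fun x => ?_, fun x hx => ?_, fun x hx => ?_⟩
  · exact HasCompactSupport.intro f_comp fun x hx => by
      simp [image_eq_zero_of_notMem_tsupport hx]
  · simpa using (f_range x).2
  · simp [f_one hx]
  · exact f_supp (subset_tsupport _ fun h => hx (by simp [h]))

variable {X : Type*} [MeasurableSpace X] {μ : Measure X} {φ : X → ℝ≥0} {P : ℝ}

theorem measure_le_lintegral_rpow [TopologicalSpace X] [T2Space X] [BorelSpace X] {K : Set X}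
    (hK : IsCompact K) (h : ∀ x ∈ K, φ x = 1) :
    μ K ≤ ∫⁻ x, (φ x : ℝ≥0∞) ^ P ∂μ := by
  rw [← lintegral_indicator_one hK.measurableSet]
  refine lintegral_mono fun x => ?_
  by_cases hx : x ∈ K
  · simp [hx, h x hx]
  · simp [hx]

theorem lintegral_rpow_le_measure (hP : 0 < P) {V : Set X} (hV : MeasurableSet V)
    (h : Function.support φ ⊆ V) (h1 : ∀ x, φ x ≤ 1) :
    ∫⁻ x, (φ x : ℝ≥0∞) ^ P ∂μ ≤ μ V := by
  rw [← lintegral_indicator_one hV]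
  refine lintegral_mono fun x => ?_
  by_cases hx : x ∈ V
  · simpa [hx] using ENNReal.rpow_le_one (by exact_mod_cast h1 x) hP.le
  · have : φ x = 0 := by_contra fun h' => hx (h h')
    simp [this, hP]

theorem measure_le_lintegral [TopologicalSpace X] [T2Space X] [BorelSpace X] {K : Set X}
    (hK : IsCompact K) (h : ∀ x ∈ K, φ x = 1) :
    μ K ≤ ∫⁻ x, φ x ∂μ := by
  simpa using measure_le_lintegral_rpow (μ := μ) (P := 1) hK h

theorem lintegral_le_measure {V : Set X} (hV : MeasurableSet V)
    (h : Function.support φ ⊆ V) (h1 : ∀ x, φ x ≤ 1) :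
    ∫⁻ x, φ x ∂μ ≤ μ V := by
  simpa using lintegral_rpow_le_measure (μ := μ) zero_lt_one hV h h1

theorem exists_isOpen_superset_measure_le_two_mul [TopologicalSpace X] [μ.OuterRegular]
    {A : Set X} (h0 : μ A ≠ 0) (ht : μ A ≠ ∞) : ∃ U ⊇ A, IsOpen U ∧ μ U ≤ 2 * μ A := by
  obtain ⟨U, hU, hU', hU''⟩ := A.exists_isOpen_lt_of_lt (2 * μ A) (by
    rw [two_mul]
    exact ENNReal.lt_add_right ht h0)
  exact ⟨U, hU, hU', hU''.le⟩

end Bump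

/-! ### Growth of powers of a compact neighbourhood, and compactness from the convolution
inequality. -/

section Group

variable {G : Type*} [Group G] [TopologicalSpace G] [IsTopologicalGroup G]

/-- `S ^ n * interior S` is open, lies in `S ^ (n + 1)` and contains `S ^ n`. This leaves room for a
bump between consecutive powers. -/
theorem pow_subset_interior_pow_succ {S : Set G} (hS : (1 : G) ∈ interior S) (n : ℕ) :
    S ^ n ⊆ interior (S ^ (n + 1)) := by
  have h1 : S ^ n * interior S ⊆ interior (S ^ (n + 1)) := by
    refine interior_maximal ?_ (isOpen_interior.mul_left)
    rw [pow_succ]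
    exact mul_subset_mul_left interior_subset
  exact fun x hx => h1 ⟨x, hx, 1, hS, mul_one x⟩

theorem isCompact_pow {S : Set G} (hS : IsCompact S) (n : ℕ) : IsCompact (S ^ n) := by
  induction n with
  | zero => simp
  | succ n ih => exact pow_succ S n ▸ ih.mul hS

variable [MeasurableSpace G] [BorelSpace G] {μ : Measure G}

/-- The measures of consecutive powers of a compact neighbourhood of `1` are comparable. -/
theorem exists_measure_pow_add_le [μ.IsMulLeftInvariant] {S : Set G} (hS : IsCompact S)
    (hS1 : (1 : G) ∈ interior S) :
    ∃ m : ℝ≥0∞, m ≠ ∞ ∧ ∀ n l : ℕ, μ (S ^ (n + 1 + l)) ≤ m ^ l * μ (S ^ (n + 1)) := by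
  -- Finitely many left translates of `S` cover `S * S`; multiplying on the right by `S ^ n` gives
  -- the same covering number for every `n`.
  obtain ⟨t, ht⟩ := compact_covered_by_mul_left_translates (hS.mul hS) ⟨1, hS1⟩
  have hstep (n : ℕ) : μ (S ^ (n + 2)) ≤ ((t.card : ℝ≥0∞) + 1) * μ (S ^ (n + 1)) := by
    have h1 : S ^ (n + 2) ⊆ ⋃ g ∈ t, (fun x => g * x) ⁻¹' (S ^ (n + 1)) := by
      rw [add_comm, pow_add, pow_two]
      rintro _ ⟨x, hx, y, hy, rfl⟩
      obtain ⟨g, hg, hgx⟩ := mem_iUnion₂.1 (ht hx)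
      refine mem_iUnion₂.2 ⟨g, hg, ?_⟩
      rw [mem_preimage, pow_succ']
      exact ⟨g * x, hgx, y, hy, by simp [mul_assoc]⟩
    refine (measure_mono h1).trans ((measure_biUnion_finset_le t _).trans ?_)
    simp only [measure_preimage_mul, Finset.sum_const, nsmul_eq_mul]
    gcongr
    exact le_self_add
  refine ⟨(t.card : ℝ≥0∞) + 1, by simp, fun n l => ?_⟩
  induction l with
  | zero => simp
  | succ l ih =>
    calc μ (S ^ (n + 1 + (l + 1))) = μ (S ^ (n + l + 2)) := by congr 2; ring
      _ ≤ ((t.card : ℝ≥0∞) + 1) * μ (S ^ (n + l + 1)) := hstep _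
      _ ≤ ((t.card : ℝ≥0∞) + 1) * (((t.card : ℝ≥0∞) + 1) ^ l * μ (S ^ (n + 1))) := by
        gcongr
        convert! ih using 3
        ring
      _ = _ := by ring

variable [T2Space G] [LocallyCompactSpace G]

/-- The convolution inequality forces products of compact sets to be large. -/
theorem ConvBound.measure_mul_measure_le [μ.IsHaarMeasure] [μ.Regular] {P : ℝ} (hP : 1 < P)
    {C : ℝ≥0∞} (H : ConvBound μ P C) {A B : Set G} (hA : IsCompact A) (hB : IsCompact B)
    (hB1 : 1 ≤ μ B) :
    μ A * μ B ≤ (4 * C) ^ (1 / (P - 1)) * 2 * μ (A * B) := by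
  have hP0 : 0 < P := by linarith
  have hP1 : 0 < P - 1 := by linarith
  rcases eq_or_ne (μ A) 0 with hA0 | hA0
  · simp [hA0]
  have hB0 : μ B ≠ 0 := (zero_lt_one.trans_le hB1).ne'
  have hAB0 : μ (A * B) ≠ 0 := by
    obtain ⟨a, ha⟩ := nonempty_of_measure_ne_zero hA0
    have h1 : μ B ≤ μ (A * B) := by
      rw [← measure_smul μ a B]
      refine measure_mono ?_
      rintro _ ⟨b, hb, rfl⟩
      exact mul_mem_mul ha hb
    exact (lt_of_lt_of_le (pos_iff_ne_zero.2 hB0) h1).ne'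
  obtain ⟨W, hABW, hW, hμW⟩ := exists_isOpen_superset_measure_le_two_mul hAB0
    (hA.mul hB).measure_lt_top.ne
  obtain ⟨U, V, hU, hV, hAU, hBV, hUV⟩ := generalized_tube_lemma hA hB
    (n := (fun z : G × G => z.1 * z.2) ⁻¹' W) (hW.preimage continuous_mul)
    (fun z hz => hABW (mul_mem_mul hz.1 hz.2))
  obtain ⟨U', hAU', hU', hμU'⟩ := exists_isOpen_superset_measure_le_two_mul hA0
    hA.measure_lt_top.ne
  obtain ⟨V', hBV', hV', hμV'⟩ := exists_isOpen_superset_measure_le_two_mul hB0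
    hB.measure_lt_top.ne
  obtain ⟨φ, φ_cont, φ_comp, φ_le, φ_one, φ_supp⟩ :=
    exists_nnreal_bump hA (hU.inter hU') (subset_inter hAU hAU')
  obtain ⟨ψ, ψ_cont, ψ_comp, ψ_le, ψ_one, ψ_supp⟩ :=
    exists_nnreal_bump hB (hV.inter hV') (subset_inter hBV hBV')
  have hsupp : Function.support (lconv μ φ ψ) ⊆ W := by
    refine (support_lconv_subset μ φ ψ).trans ?_
    rintro _ ⟨x, hx, y, hy, rfl⟩
    exact hUV (mk_mem_prod (φ_supp hx).1 (ψ_supp hy).1)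
  have hψ1 : 1 ≤ 2 * ∫⁻ x, (ψ x : ℝ≥0∞) ^ P ∂μ := by
    refine (hB1.trans (measure_le_lintegral_rpow (P := P) hB ψ_one)).trans ?_
    exact le_mul_of_one_le_left bot_le (by norm_num)
  set t := μ A * μ B with ht
  have ht0 : t ≠ 0 := mul_ne_zero hA0 hB0
  have htt : t ≠ ∞ := ENNReal.mul_ne_top hA.measure_lt_top.ne hB.measure_lt_top.ne
  -- The mass of `φ * ψ` is at least `t` and sits in `W`, so Hölder compares `t ^ P` with the `P`-th
  -- power of its norm, which is controlled by a multiple of `t`. Cancelling `t` leaves an exponent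
  -- `P - 1 > 0`.
  have key : t ^ (P - 1) * t ≤ ((2 * μ (A * B)) ^ (P - 1) * (4 * C)) * t := by
    calc t ^ (P - 1) * t = t ^ P := by
          nth_rewrite 2 [← ENNReal.rpow_one t]
          rw [← ENNReal.rpow_add _ _ ht0 htt, sub_add_cancel]
      _ ≤ ((∫⁻ x, φ x ∂μ) * ∫⁻ x, ψ x ∂μ) ^ P := by
          refine ENNReal.rpow_le_rpow ?_ hP0.le
          exact mul_le_mul' (measure_le_lintegral hA φ_one) (measure_le_lintegral hB ψ_one)
      _ = (∫⁻ x, lconv μ φ ψ x ∂μ) ^ P := by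
          rw [lintegral_lconv φ_cont ψ_cont φ_comp ψ_comp]
      _ ≤ μ W ^ (P - 1) * ∫⁻ x, lconv μ φ ψ x ^ P ∂μ :=
          lintegral_rpow_le_of_support_subset hP
            (measurable_lconv φ_cont ψ_cont φ_comp ψ_comp).aemeasurable hW.measurableSet hsupp
      _ ≤ (2 * μ (A * B)) ^ (P - 1) * (C * (2 * μ A) * (2 * μ B)) := by
          gcongr
          refine (H φ ψ φ_cont φ_comp ψ_cont ψ_comp ψ_le hψ1).trans ?_
          gcongr
          · exact (lintegral_rpow_le_measure hP0 hU'.measurableSet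
              (φ_supp.trans inter_subset_right) φ_le).trans hμU'
          · exact (lintegral_rpow_le_measure hP0 hV'.measurableSet
              (ψ_supp.trans inter_subset_right) ψ_le).trans hμV'
      _ = _ := by rw [ht]; ring
  rw [ENNReal.mul_le_mul_iff_left ht0 htt] at key
  have := ENNReal.rpow_le_rpow key (z := 1 / (P - 1)) (by positivity)
  rw [ENNReal.mul_rpow_of_nonneg ((2 * μ (A * B)) ^ (P - 1)) _ (by positivity),
    ← ENNReal.rpow_mul, ← ENNReal.rpow_mul,
    mul_one_div_cancel hP1.ne', ENNReal.rpow_one, ENNReal.rpow_one] at this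
  calc t ≤ _ := this
    _ = _ := by ring

/-- The measures of powers of a symmetric compact set are almost submultiplicative. -/
theorem measure_mul_measure_pow_add_le [μ.IsHaarMeasure] {S : Set G} (hS : IsCompact S)
    (hS1 : (1 : G) ∈ interior S) (hSi : S⁻¹ = S) (i j : ℕ) :
    μ S * μ (S ^ (i + j)) ≤ μ (S ^ (i + 2)) * μ (S ^ (j + 2)) := by
  have hc (n : ℕ) : IsCompact (S ^ n) := isCompact_pow hS n
  obtain ⟨φ, φ_cont, φ_comp, φ_le, φ_one, φ_supp⟩ :=
    exists_nnreal_bump (hc (i + 1)) isOpen_interior (pow_subset_interior_pow_succ hS1 (i + 1))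
  obtain ⟨ψ, ψ_cont, ψ_comp, ψ_le, ψ_one, ψ_supp⟩ :=
    exists_nnreal_bump (hc (j + 1)) isOpen_interior (pow_subset_interior_pow_succ hS1 (j + 1))
  -- For `x = a * b` with `a ∈ S ^ i`, `b ∈ S ^ j`, both factors of the integrand equal `1` on the
  -- translate `a • S`; symmetry of `S` puts `s⁻¹ * b` in `S ^ (j + 1)`.
  have hlow (x : G) (hx : x ∈ S ^ (i + j)) : μ S ≤ lconv μ φ ψ x := by
    rw [pow_add] at hx
    obtain ⟨a, ha, b, hb, rfl⟩ := hx
    rw [← measure_smul μ a S, ← lintegral_indicator_one (hS.smul a).measurableSet]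
    refine lintegral_mono fun y => ?_
    by_cases hy : y ∈ a • S
    · obtain ⟨s, hs, rfl⟩ := hy
      have h1 : φ (a * s) = 1 := φ_one _ (by rw [pow_succ]; exact mul_mem_mul ha hs)
      have h2 : ψ (s⁻¹ * b) = 1 := ψ_one _ (by
        rw [pow_succ']
        refine mul_mem_mul ?_ hb
        rw [← hSi]
        exact inv_mem_inv.2 hs)
      have h3 : (a * s)⁻¹ * (a * b) = s⁻¹ * b := by group
      have h4 : (a • S).indicator (1 : G → ℝ≥0∞) (a • s) = 1 :=
        indicator_of_mem (smul_mem_smul_set hs) _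
      dsimp only
      rw [h4, smul_eq_mul, h1, h3, h2]
      simp
    · simp [hy]
  calc μ S * μ (S ^ (i + j)) = ∫⁻ x, (S ^ (i + j)).indicator (fun _ => μ S) x ∂μ := by
        rw [lintegral_indicator_const (hc _).measurableSet]
    _ ≤ ∫⁻ x, lconv μ φ ψ x ∂μ := by
        refine lintegral_mono fun x => ?_
        by_cases hx : x ∈ S ^ (i + j)
        · simpa [hx] using hlow x hx
        · simp [hx]
    _ = (∫⁻ x, φ x ∂μ) * ∫⁻ x, ψ x ∂μ := lintegral_lconv φ_cont ψ_cont φ_comp ψ_comp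
    _ ≤ _ := mul_le_mul'
        (lintegral_le_measure (hc _).measurableSet (φ_supp.trans interior_subset) φ_le)
        (lintegral_le_measure (hc _).measurableSet (ψ_supp.trans interior_subset) ψ_le)

/-- The `L^p` conjecture: the convolution inequality holds on compact groups only. -/
theorem ConvBound.compactSpace [μ.IsHaarMeasure] [μ.Regular] {P : ℝ} (hP : 1 < P)
    {C : ℝ≥0∞} (hC : C ≠ ∞) (H : ConvBound μ P C) : CompactSpace G := by
  by_contra hG
  rw [not_compactSpace_iff] at hG
  have hP0 : 0 < P := by linarith
  set D : ℝ≥0∞ := (4 * C) ^ (1 / (P - 1)) * 2 with hD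
  have hDt : D ≠ ∞ := ENNReal.mul_ne_top
    (ENNReal.rpow_ne_top_of_nonneg (by simp [hP.le]) (ENNReal.mul_ne_top (by simp) hC)) (by simp)
  -- Noncompactness gives infinite total measure, hence compact sets of any size. The summand `2 *
  -- D` forces doubling of the powers; the summand `1` makes their measures at least `1`.
  obtain ⟨S, hS, hS1, hSi, hSμ⟩ : ∃ S : Set G, IsCompact S ∧ (1 : G) ∈ interior S ∧ S⁻¹ = S ∧
      1 + 2 * D ≤ μ S := by
    obtain ⟨K, -, hK, hμK⟩ := isOpen_univ.exists_lt_isCompact (μ := μ) (U := (univ : Set G))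
      (r := 1 + 2 * D) (by
        rw [measure_univ_of_isMulLeftInvariant]
        exact (ENNReal.add_ne_top.2 ⟨by simp, ENNReal.mul_ne_top (by simp) hDt⟩).lt_top)
    obtain ⟨N, hN, hN1⟩ := exists_compact_mem_nhds (1 : G)
    refine ⟨(K ∪ N) ∪ (K ∪ N)⁻¹, (hK.union hN).union (hK.union hN).inv, ?_, ?_, ?_⟩
    · exact interior_mono (subset_union_right.trans subset_union_left)
        (mem_interior_iff_mem_nhds.2 hN1)
    · rw [union_inv, inv_inv, union_comm]
    · exact hμK.le.trans (measure_mono (subset_union_left.trans subset_union_left))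
  have hc (n : ℕ) : IsCompact (S ^ n) := isCompact_pow hS n
  have hfin (n : ℕ) : μ (S ^ n) ≠ ∞ := (hc n).measure_lt_top.ne
  have hmono {n l : ℕ} (h : n ≤ l) : S ^ n ⊆ S ^ l :=
    pow_subset_pow_right (interior_subset hS1) h
  have hS1μ : 1 ≤ μ S := le_self_add.trans hSμ
  have hpow1 (n : ℕ) : 1 ≤ μ (S ^ (n + 1)) :=
    hS1μ.trans (measure_mono (by simpa using hmono (Nat.le_add_left 1 n)))
  have hgrow (n : ℕ) : 2 * μ (S ^ (n + 1)) ≤ μ (S ^ (n + 2)) := by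
    rcases eq_or_ne D 0 with h0 | h0
    · exfalso
      have := H.measure_mul_measure_le hP hS (hc 1) (by simpa using hpow1 0)
      rw [← hD, h0, zero_mul, nonpos_iff_eq_zero, mul_eq_zero, pow_one, or_self] at this
      rw [this] at hS1μ
      exact absurd hS1μ (by simp)
    have h1 := H.measure_mul_measure_le hP hS (hc (n + 1)) (hpow1 n)
    rw [← hD, ← pow_succ'] at h1
    have h2 : 2 * D * μ (S ^ (n + 1)) ≤ D * μ (S ^ (n + 2)) :=
      (mul_le_mul_left (le_add_self.trans hSμ) _).trans h1
    rw [mul_comm 2 D, mul_assoc] at h2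
    exact (ENNReal.mul_le_mul_iff_right h0 hDt).1 h2
  obtain ⟨m, hmt, hm⟩ := exists_measure_pow_add_le (μ := μ) hS hS1
  -- the shells
  have hshell (n : ℕ) : μ (S ^ (n + 2)) ≤ 2 * μ (S ^ (n + 2) \ interior (S ^ (n + 1))) := by
    set a := μ (S ^ (n + 2))
    set d := μ (S ^ (n + 2) \ interior (S ^ (n + 1)))
    have h1 : a ≤ d + μ (S ^ (n + 1)) := by
      refine (measure_mono (t := (S ^ (n + 2) \ interior (S ^ (n + 1))) ∪ S ^ (n + 1))
        fun x hx => ?_).trans (measure_union_le _ _)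
      by_cases hx' : x ∈ interior (S ^ (n + 1))
      · exact Or.inr (interior_subset hx')
      · exact Or.inl ⟨hx, hx'⟩
    have h2 : a + a ≤ 2 * d + a := by
      calc a + a = 2 * a := (two_mul a).symm
        _ ≤ 2 * (d + μ (S ^ (n + 1))) := by gcongr
        _ = 2 * d + 2 * μ (S ^ (n + 1)) := mul_add _ _ _
        _ ≤ _ := by gcongr; exact hgrow n
    exact (ENNReal.add_le_add_iff_right (hfin (n + 2))).1 h2
  -- With step `3` the bumps are disjoint: `ψ i` lives in `S ^ (3 * i + 4)`, and the next one
  -- vanishes there because its open set excludes `S ^ (3 * (i + 1) + 1)`.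
  have hbump (i : ℕ) := exists_nnreal_bump
    (K := S ^ (3 * i + 3) \ interior (S ^ (3 * i + 2)))
    (V := interior (S ^ (3 * i + 4)) \ S ^ (3 * i + 1))
    ((hc _).diff isOpen_interior) (isOpen_interior.sdiff (hc _).isClosed) (fun x hx =>
      ⟨pow_subset_interior_pow_succ hS1 _ hx.1, fun hx' =>
        hx.2 (pow_subset_interior_pow_succ hS1 _ hx')⟩)
  choose ψ ψ_cont ψ_comp ψ_le ψ_one ψ_supp using hbump
  have hKc (i : ℕ) : IsCompact (S ^ (3 * i + 3) \ interior (S ^ (3 * i + 2))) :=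
    (hc _).diff isOpen_interior
  have hMc (i : ℕ) : ((μ (S ^ (3 * i + 3))).toNNReal : ℝ≥0∞) = μ (S ^ (3 * i + 3)) :=
    ENNReal.coe_toNNReal (hfin _)
  have hsupp' (i : ℕ) : Function.support (ψ i) ⊆ S ^ (3 * i + 4) :=
    (ψ_supp i).trans (sdiff_subset.trans interior_subset)
  -- The exponent `3 * k + 8` is the sum of `3 * i + 4` and `3 * j + 4`. Submultiplicativity costs
  -- two more powers in each factor, so `S ^ (3 * i + 6)` is compared with `S ^ (3 * i + 3)`: a
  -- factor `m ^ 3` for each of `i` and `j`.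
  refine not_convBound_of_multiscale (μ := μ) hP hC (m := m) (E := m ^ 6) hmt
    (ENNReal.pow_ne_top hmt) ψ (fun i => (μ (S ^ (3 * i + 3))).toNNReal)
    (fun k => S ^ (3 * k + 8)) ψ_cont ψ_comp (fun i => ?_) ?_ ψ_le (fun i => ?_) (fun i => ?_)
    (fun i => ?_) (fun k => (hc _).measurableSet) (fun k => ?_) (fun i j => ?_) (fun i j => ?_) H
  · rw [← ENNReal.coe_le_coe, hMc]
    exact hpow1 _
  · have hlt {i j : ℕ} (hij : i < j) (x : G) : ψ i x = 0 ∨ ψ j x = 0 := by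
      by_contra! h
      refine (ψ_supp j h.2).2 (hmono ?_ (hsupp' i h.1))
      lia
    intro i j hij x
    rcases lt_or_gt_of_ne hij with h | h
    · exact hlt h x
    · exact (hlt h x).symm
  · rw [hMc]
    refine (hshell (3 * i + 1)).trans ?_
    gcongr
    exact measure_le_lintegral (hKc i) (ψ_one i)
  · rw [hMc]
    refine (hshell (3 * i + 1)).trans ?_
    gcongr
    exact measure_le_lintegral_rpow (hKc i) (ψ_one i)
  · rw [hMc]
    refine (lintegral_rpow_le_measure hP0 (hc _).measurableSet (hsupp' i) (ψ_le i)).trans ?_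
    simpa using hm (3 * i + 2) 1
  · exact (zero_lt_one.trans_le (hpow1 (3 * k + 7))).ne'
  · refine (mul_subset_mul (hsupp' i) (hsupp' j)).trans ?_
    rw [← pow_add]
    exact hmono (by lia)
  · rw [hMc, hMc]
    have h1 := measure_mul_measure_pow_add_le (μ := μ) hS hS1 hSi (3 * i + 4) (3 * j + 4)
    have h2 := hm (3 * i + 2) 3
    have h3 := hm (3 * j + 2) 3
    calc μ (S ^ (3 * (i + j) + 8)) = μ (S ^ (3 * i + 4 + (3 * j + 4))) := by congr 2; ring
      _ ≤ μ S * μ (S ^ (3 * i + 4 + (3 * j + 4))) := le_mul_of_one_le_left bot_le hS1μ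
      _ ≤ μ (S ^ (3 * i + 4 + 2)) * μ (S ^ (3 * j + 4 + 2)) := h1
      _ ≤ (m ^ 3 * μ (S ^ (3 * i + 3))) * (m ^ 3 * μ (S ^ (3 * j + 3))) := mul_le_mul' h2 h3
      _ = _ := by ring

end Group

/-! ### Series of compactly supported continuous functions representing `L^p` functions. -/

section Series

theorem summable_norm_of_tsum_enorm_ne_top {ι : Type*} {u : ι → ℂ} (h : ∑' i, ‖u i‖ₑ ≠ ∞) :
    Summable fun i => ‖u i‖ := by
  have : Summable fun i => ‖u i‖₊ := ENNReal.tsum_coe_ne_top_iff_summable.1 h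
  exact NNReal.summable_coe.2 this

/-- Every function in `L^p` is the sum of an almost everywhere absolutely convergent series of
continuous functions with compact support, with good control of the norms. -/
theorem exists_series_of_memLp {X : Type*} [TopologicalSpace X]
    [LocallyCompactSpace X] [T2Space X] [MeasurableSpace X] [BorelSpace X] {μ : Measure X}
    [μ.Regular] {p : ℝ≥0∞} (hp : 1 ≤ p) (hp' : p ≠ ∞) {f : X → ℂ} (hf : MemLp f p μ) {ε : ℝ≥0∞}
    (hε : ε ≠ 0) :
    ∃ u : ℕ → X → ℂ, (∀ n, Continuous (u n)) ∧ (∀ n, HasCompactSupport (u n)) ∧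
      ∑' n, eLpNorm (u n) p μ ≤ eLpNorm f p μ + ε ∧ ∀ᵐ x ∂μ, HasSum (fun n => u n x) (f x) := by
  -- Half of `ε`, because each `δ n` enters the norm estimates of two consecutive terms of the
  -- telescoping series.
  obtain ⟨δ, hδ, hδε⟩ := ENNReal.exists_pos_sum_of_countable' (ENNReal.half_pos hε).ne' ℕ
  choose h hle h_cont h_comp h_mem using fun n =>
    exists_continuous_hasCompactSupport_eLpNorm_sub_le hp' hf (hδ n).ne'
  have hδt : ∑' n, δ n ≠ ∞ := (hδε.trans_le le_top).ne
  let u : ℕ → X → ℂ := fun n => Nat.casesOn n (h 0) fun k => h (k + 1) - h k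
  have hu0 : u 0 = h 0 := rfl
  have hus (k : ℕ) : u (k + 1) = h (k + 1) - h k := rfl
  have hle' (n : ℕ) : eLpNorm (h n - f) p μ ≤ δ n := by
    rw [← eLpNorm_neg, neg_sub]
    exact hle n
  have hn0 : eLpNorm (u 0) p μ ≤ eLpNorm f p μ + δ 0 := by
    have : u 0 = f + (h 0 - f) := by rw [hu0]; abel
    rw [this]
    exact (eLpNorm_add_le hf.1 ((h_mem 0).1.sub hf.1) hp).trans (by gcongr; exact hle' 0)
  have hns (k : ℕ) : eLpNorm (u (k + 1)) p μ ≤ δ k + δ (k + 1) := by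
    have : u (k + 1) = (f - h k) + (h (k + 1) - f) := by rw [hus]; abel
    rw [this]
    exact (eLpNorm_add_le (hf.1.sub (h_mem k).1) ((h_mem (k + 1)).1.sub hf.1) hp).trans
      (add_le_add (hle k) (hle' (k + 1)))
  refine ⟨u, fun n => ?_, fun n => ?_, ?_, ?_⟩
  · cases n with
    | zero => exact h_cont 0
    | succ k => exact (h_cont (k + 1)).sub (h_cont k)
  · cases n with
    | zero => exact h_comp 0
    | succ k => exact (h_comp (k + 1)).sub (h_comp k)
  · have e1 : ∑' n, δ n = δ 0 + ∑' k, δ (k + 1) := tsum_eq_zero_add' ENNReal.summable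
    calc ∑' n, eLpNorm (u n) p μ = eLpNorm (u 0) p μ + ∑' k, eLpNorm (u (k + 1)) p μ :=
          tsum_eq_zero_add' ENNReal.summable
      _ ≤ (eLpNorm f p μ + δ 0) + ∑' k, (δ k + δ (k + 1)) :=
          add_le_add hn0 (ENNReal.tsum_le_tsum hns)
      _ = eLpNorm f p μ + (∑' n, δ n + ∑' n, δ n) := by
          rw [ENNReal.tsum_add]
          nth_rewrite 3 [e1]
          ring
      _ ≤ eLpNorm f p μ + (ε / 2 + ε / 2) := by gcongr
      _ = _ := by rw [ENNReal.add_halves]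
  · have hmeas (n : ℕ) : AEMeasurable (fun x => ‖f x - h n x‖ₑ) μ :=
      (hf.1.sub (h_mem n).1).enorm
    -- Summable errors in norm give, by Minkowski, almost everywhere summable errors; this yields
    -- both the limit and absolute convergence.
    have h1 : eLpNorm (fun x => ∑' n, ‖f x - h n x‖ₑ) p μ ≠ ∞ := by
      refine ne_top_of_le_ne_top hδt ((eLpNorm_tsum_le hp hp' hmeas).trans
        (ENNReal.tsum_le_tsum fun n => ?_))
      exact (eLpNorm_enorm (f - h n)).trans_le (hle n)
    filter_upwards [ae_lt_top_of_eLpNorm_ne_top hp hp' (AEMeasurable.tsum hmeas) h1]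
      with x hx
    have hd : Summable fun n => ‖f x - h n x‖ := summable_norm_of_tsum_enorm_ne_top hx.ne
    have hlim : Tendsto (fun n => h n x) atTop (𝓝 (f x)) := by
      rw [tendsto_iff_norm_sub_tendsto_zero]
      simpa only [norm_sub_rev] using hd.tendsto_atTop_zero
    have hpart (n : ℕ) : ∑ i ∈ Finset.range (n + 1), u i x = h n x := by
      induction n with
      | zero => simp [hu0]
      | succ n ih => rw [Finset.sum_range_succ, ih, hus, Pi.sub_apply, add_sub_cancel]
    have hsum : Summable fun n => u n x := by
      refine (summable_nat_add_iff 1).1 (Summable.of_norm_bounded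
        (hd.add ((summable_nat_add_iff 1).2 hd)) fun n => ?_)
      rw [hus, Pi.sub_apply, show h (n + 1) x - h n x = (f x - h n x) - (f x - h (n + 1) x) by ring]
      exact norm_sub_le _ _
    have h2 := (hsum.hasSum.tendsto_sum_nat).comp (tendsto_add_atTop_nat 1)
    simp only [Function.comp_def, hpart] at h2
    rw [tendsto_nhds_unique hlim h2]
    exact hsum.hasSum

end Series

/-! ### Tempered functions obtained from series. -/

section Convolution

variable {G : Type*} [TopologicalSpace G] [Group G] [IsTopologicalGroup G]
    [LocallyCompactSpace G] [T2Space G] [MeasurableSpace G] [BorelSpace G]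
    {μ : Measure G} [μ.Regular] {p : ℝ≥0∞}

/-- If `f` is a sum of continuous functions `u n` with compact support, each of which convolves
`L^p` into `L^p`, with summable norms, then `f` convolves `L^p` into `L^p`. -/
theorem conv_of_series (hp : 1 ≤ p) (hp' : p ≠ ∞) {f : G → ℂ} {u : ℕ → G → ℂ} {κ : ℕ → ℝ≥0∞}
    (hu : ∀ n, Continuous (u n)) (h'u : ∀ n, HasCompactSupport (u n))
    (hκ : ∀ n (φ : G → ℝ≥0), Continuous φ → HasCompactSupport φ →
      eLpNorm (lconv μ φ fun x => ‖u n x‖₊) p μ ≤ κ n * nnLpNorm p μ φ)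
    (hκt : ∑' n, κ n ≠ ∞) (hf : ∀ x, ∀ᵐ y ∂μ, HasSum (fun n => u n (y⁻¹ * x)) (f (y⁻¹ * x)))
    {g : G → ℂ} (hg : MemLp g p μ) :
    ConvExists μ g f ∧ AEStronglyMeasurable (conv μ g f) μ ∧
      eLpNorm (conv μ g f) p μ ≤ (∑' n, κ n) * (eLpNorm g p μ + 1) := by
  obtain ⟨v, hv, h'v, hvle, hvsum⟩ := exists_series_of_memLp hp hp' hg one_ne_zero
  have hn {w : G → ℂ} (hw : HasCompactSupport w) : HasCompactSupport fun x => ‖w x‖₊ :=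
    hw.comp_left (g := fun z : ℂ => ‖z‖₊) nnnorm_zero
  set L : ℕ → ℕ → G → ℝ≥0∞ := fun m n => lconv μ (fun x => ‖v m x‖₊) (fun x => ‖u n x‖₊) with hL
  have hLm (m n : ℕ) : Measurable (L m n) :=
    measurable_lconv (hv m).nnnorm (hu n).nnnorm (hn (h'v m)) (hn (h'u n))
  -- With `g` expanded too, `T` dominates the convolution of the absolute values. It lies in `L^p`,
  -- so wherever it is finite the double series may be integrated term by term, which also gives
  -- measurability of `g * f`.
  set T : G → ℝ≥0∞ := fun x => ∑' m, ∑' n, L m n x with hT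
  have hTm : Measurable T := Measurable.tsum fun m => Measurable.tsum fun n => hLm m n
  have hTle : eLpNorm T p μ ≤ (∑' n, κ n) * (eLpNorm g p μ + 1) := by
    calc eLpNorm T p μ ≤ ∑' m, eLpNorm (fun x => ∑' n, L m n x) p μ :=
          eLpNorm_tsum_le hp hp' fun m => (Measurable.tsum fun n => hLm m n).aemeasurable
      _ ≤ ∑' m, ∑' n, eLpNorm (L m n) p μ := ENNReal.tsum_le_tsum fun m =>
          eLpNorm_tsum_le hp hp' fun n => (hLm m n).aemeasurable
      _ ≤ ∑' m, ∑' n, κ n * eLpNorm (v m) p μ := by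
          refine ENNReal.tsum_le_tsum fun m => ENNReal.tsum_le_tsum fun n => ?_
          refine (hκ n _ (hv m).nnnorm (hn (h'v m))).trans_eq ?_
          exact congrArg (κ n * ·) (eLpNorm_enorm (v m))
      _ = (∑' n, κ n) * ∑' m, eLpNorm (v m) p μ := by
          simp_rw [ENNReal.tsum_mul_right, ENNReal.tsum_mul_left]
      _ ≤ _ := by gcongr
  have hTt : eLpNorm T p μ ≠ ∞ := ne_top_of_le_ne_top
    (ENNReal.mul_ne_top hκt (ENNReal.add_ne_top.2 ⟨hg.2.ne, ENNReal.one_ne_top⟩)) hTle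
  set w : ℕ × ℕ → G → G → ℂ := fun z x y => v z.1 y * u z.2 (y⁻¹ * x) with hw
  have hwc (z : ℕ × ℕ) (x : G) : AEStronglyMeasurable (w z x) μ := by
    have : Continuous (w z x) := (hv z.1).mul ((hu z.2).comp (by fun_prop))
    have hc : HasCompactSupport (w z x) := (h'v z.1).mul_right
    exact (this.stronglyMeasurable_of_hasCompactSupport hc).aestronglyMeasurable
  have hwL (x : G) : ∑' z, ∫⁻ y, ‖w z x y‖ₑ ∂μ = T x := by
    rw [ENNReal.tsum_prod']
    simp only [hw, hT, hL, lconv, enorm_mul]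
    rfl
  have hsum (x : G) : ∀ᵐ y ∂μ, HasSum (fun z => w z x y) (g y * f (y⁻¹ * x)) := by
    filter_upwards [hvsum, hf x] with y hy hy'
    have h1 : Summable fun z : ℕ × ℕ => v z.1 y * u z.2 (y⁻¹ * x) :=
      summable_mul_of_summable_norm' (f := fun m => v m y) (g := fun n => u n (y⁻¹ * x))
        hy.summable.norm hy.summable hy'.summable.norm hy'.summable
    exact HasSum.mul (f := fun m => v m y) (g := fun n => u n (y⁻¹ * x)) hy hy' h1
  have hae (x : G) : (fun y => g y * f (y⁻¹ * x)) =ᵐ[μ] fun y => ∑' z, w z x y := by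
    filter_upwards [hsum x] with y hy
    exact hy.tsum_eq.symm
  have hle (x : G) : ∫⁻ y, ‖g y * f (y⁻¹ * x)‖ₑ ∂μ ≤ T x := by
    rw [← hwL, ← lintegral_tsum fun z => (hwc z x).enorm]
    refine lintegral_mono_ae ?_
    filter_upwards [hae x] with y hy
    rw [hy]
    exact enorm_tsum_le_tsum_enorm
  have hTae := ae_lt_top_of_eLpNorm_ne_top hp hp' hTm.aemeasurable hTt
  refine ⟨?_, ?_, ?_⟩
  · filter_upwards [hTae] with x hx
    exact ⟨(AEStronglyMeasurable.tsum (L := .unconditional _) fun z => hwc z x).congr (hae x).symm,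
      (hle x).trans_lt hx⟩
  · have h1 (z : ℕ × ℕ) : AEStronglyMeasurable (fun x => ∫ y, w z x y ∂μ) μ :=
      (stronglyMeasurable_integral_of_hasCompactSupport (continuous_mul_inv_mul (hv z.1) (hu z.2))
        (hasCompactSupport_mul_inv_mul (h'v z.1) (h'u z.2)) μ).aestronglyMeasurable
    refine (AEStronglyMeasurable.tsum (L := .unconditional _) h1).congr ?_
    filter_upwards [hTae] with x hx
    rw [conv, integral_congr_ae (hae x), integral_tsum (hwc · x) (by rw [hwL]; exact hx.ne)]
  · refine (eLpNorm_mono_enorm fun x => ?_).trans hTle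
    exact (enorm_integral_le_lintegral_enorm _).trans (hle x)

theorem mem_LpT_of_series (hp : 1 ≤ p) (hp' : p ≠ ∞) {f : G → ℂ} (hfp : MemLp f p μ)
    {u : ℕ → G → ℂ} {κ : ℕ → ℝ≥0∞}
    (hu : ∀ n, Continuous (u n)) (h'u : ∀ n, HasCompactSupport (u n))
    (hκ : ∀ n (φ : G → ℝ≥0), Continuous φ → HasCompactSupport φ →
      eLpNorm (lconv μ φ fun x => ‖u n x‖₊) p μ ≤ κ n * nnLpNorm p μ φ)
    (hκt : ∑' n, κ n ≠ ∞) (hf : ∀ x, ∀ᵐ y ∂μ, HasSum (fun n => u n (y⁻¹ * x)) (f (y⁻¹ * x))) :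
    f ∈ LpT p μ ∧ normT p μ f ≤ 2 * ∑' n, κ n := by
  have h1 : normT p μ f ≤ 2 * ∑' n, κ n := by
    refine iSup_le fun g => iSup₂_le fun hg hg1 => ?_
    refine (conv_of_series hp hp' hu h'u hκ hκt hf hg).2.2.trans ?_
    rw [mul_comm, ← one_add_one_eq_two]
    gcongr
  refine ⟨⟨hfp, fun g hg => ?_, h1.trans_lt (ENNReal.mul_ne_top (by simp) hκt).lt_top⟩, h1⟩
  have := conv_of_series hp hp' hu h'u hκ hκt hf hg
  exact ⟨this.1, this.2.1⟩

end Convolution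

/-! ### Invariance of Haar measure on unimodular and compact groups. -/

section Invariance

variable {G : Type*} [TopologicalSpace G] [Group G] [IsTopologicalGroup G]
  [MeasurableSpace G] [BorelSpace G]

theorem IsUnimodular.isMulRightInvariant [LocallyCompactSpace G] (hG : IsUnimodular G)
    (μ : Measure G) [μ.IsHaarMeasure] [μ.Regular] : μ.IsMulRightInvariant := by
  refine ⟨fun g => ?_⟩
  have : (μ.map (· * g)).Regular := Measure.Regular.map (Homeomorph.mulRight g)
  have h1 := Measure.isMulLeftInvariant_eq_smul_of_regular (μ.map (· * g)) μ
  have h2 : Measure.haarScalarFactor (μ.map (· * g)) μ = 1 :=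
    (Measure.modularCharacterFun_eq_haarScalarFactor μ g).symm.trans (hG g)
  rw [h1, h2, one_smul]

/-- A right translate of `μ` is a multiple of `μ` with the same finite nonzero total mass. -/
theorem isMulRightInvariant_of_compactSpace [CompactSpace G]
    (μ : Measure G) [μ.IsHaarMeasure] : μ.IsMulRightInvariant := by
  refine ⟨fun g => ?_⟩
  have h1 := Measure.isMulInvariant_eq_smul_of_compactSpace (μ.map (· * g)) μ
  have h2 : μ.map (· * g) univ = μ univ := by
    rw [Measure.map_apply (measurable_mul_const g) MeasurableSet.univ, preimage_univ]
  rw [h1, Measure.smul_apply, ENNReal.smul_def, smul_eq_mul] at h2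
  have h3 : ((Measure.haarScalarFactor (μ.map (· * g)) μ : ℝ≥0) : ℝ≥0∞) = 1 := by
    have h0 : μ univ ≠ 0 := isOpen_univ.measure_ne_zero μ univ_nonempty
    exact (ENNReal.mul_eq_right h0 (measure_ne_top μ univ)).1 h2
  rw [h1, show Measure.haarScalarFactor (μ.map (· * g)) μ = 1 by exact_mod_cast h3, one_smul]

theorem isInvInvariant_of_compactSpace [CompactSpace G]
    (μ : Measure G) [μ.IsHaarMeasure] : μ.IsInvInvariant := by
  have := isMulRightInvariant_of_compactSpace μ
  have h0 : μ univ ≠ 0 := isOpen_univ.measure_ne_zero μ univ_nonempty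
  have hf : IsFiniteMeasureOnCompacts μ.inv :=
    (inferInstance : IsFiniteMeasureOnCompacts (μ.map (Homeomorph.inv G)))
  have h1 := Measure.isMulInvariant_eq_smul_of_compactSpace μ.inv μ
  have h2 : μ.inv univ = μ univ := by rw [Measure.inv_apply, inv_univ]
  rw [h1, Measure.smul_apply, ENNReal.smul_def, smul_eq_mul] at h2
  have h3 : ((Measure.haarScalarFactor μ.inv μ : ℝ≥0) : ℝ≥0∞) = 1 :=
    (ENNReal.mul_eq_right h0 (measure_ne_top μ univ)).1 h2
  refine ⟨?_⟩
  rw [h1, show Measure.haarScalarFactor μ.inv μ = 1 by exact_mod_cast h3, one_smul]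

end Invariance

/-! ### Passage between nonnegative and complex functions. -/

section Coercions

theorem enorm_coe_nnreal (r : ℝ≥0) : ‖((r : ℝ) : ℂ)‖ₑ = r := by
  rw [← ofReal_norm, Complex.norm_real, NNReal.norm_eq, ENNReal.ofReal_coe_nnreal]

theorem eLpNorm_coe_nnreal {X : Type*} [MeasurableSpace X] (p : ℝ≥0∞) (μ : Measure X)
    (θ : X → ℝ≥0) : eLpNorm (fun x => ((θ x : ℝ) : ℂ)) p μ = nnLpNorm p μ θ :=
  eLpNorm_congr_enorm_ae (.of_forall fun x => enorm_coe_nnreal (θ x))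

theorem eLpNorm_const_mul {X : Type*} [MeasurableSpace X] {p : ℝ≥0∞} (hp : 1 < p) (hp' : p < ∞)
    (μ : Measure X) (c : ℝ≥0) (F : X → ℝ≥0∞) :
    eLpNorm (fun x => c * F x) p μ = c * eLpNorm F p μ := by
  have hP0 : 0 < p.toReal := ENNReal.toReal_pos (zero_lt_one.trans hp).ne' hp'.ne
  apply (ENNReal.strictMono_rpow_of_pos hP0).injective
  simp only
  rw [ENNReal.mul_rpow_of_nonneg _ _ hP0.le, eLpNorm_rpow_toReal hp hp',
    eLpNorm_rpow_toReal hp hp', ← lintegral_const_mul' _ _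
      (ENNReal.rpow_ne_top_of_nonneg hP0.le ENNReal.coe_ne_top)]
  simp_rw [ENNReal.mul_rpow_of_nonneg _ _ hP0.le]

theorem enorm_conv_coe {G : Type*} [Group G] [MeasurableSpace G] {μ : Measure G}
    {φ F : G → ℝ≥0} {x : G}
    (h : Integrable (fun y => ((φ y : ℝ) : ℂ) * ((F (y⁻¹ * x) : ℝ) : ℂ)) μ) :
    ‖conv μ (fun y => ((φ y : ℝ) : ℂ)) (fun y => ((F y : ℝ) : ℂ)) x‖ₑ = lconv μ φ F x := by
  have e (y : G) : ((φ y : ℝ) : ℂ) * ((F (y⁻¹ * x) : ℝ) : ℂ) =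
      (((φ y * F (y⁻¹ * x) : ℝ≥0) : ℝ) : ℂ) := by push_cast; rfl
  simp_rw [e] at h
  have h1 : Integrable (fun y => ((φ y * F (y⁻¹ * x) : ℝ≥0) : ℝ)) μ := by
    simpa using h.re
  have h2 := lintegral_coe_eq_integral _ h1
  simp only [conv, lconv]
  simp_rw [e]
  rw [integral_complex_ofReal]
  simp_rw [ENNReal.coe_mul] at h2
  rw [h2, ← ofReal_norm, Complex.norm_real, Real.norm_of_nonneg]
  exact integral_nonneg fun y => NNReal.coe_nonneg _

end Coercions

/-! ### Young's inequality and its consequences. -/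

section Bounds

variable {G : Type*} [TopologicalSpace G] [Group G] [IsTopologicalGroup G]
  [MeasurableSpace G] [BorelSpace G] {μ : Measure G} [μ.IsHaarMeasure] {p : ℝ≥0∞}

/-- Young's inequality for a bi-invariant measure. -/
theorem eLpNorm_lconv_le [μ.IsMulRightInvariant] (hp : 1 < p) (hp' : p < ∞)
    {φ ψ : G → ℝ≥0} (hφ : Continuous φ) (hψ : Continuous ψ) (h'φ : HasCompactSupport φ)
    (h'ψ : HasCompactSupport ψ) :
    eLpNorm (lconv μ φ ψ) p μ ≤ (∫⁻ x, ψ x⁻¹ ∂μ) * nnLpNorm p μ φ := by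
  have hP : 1 < p.toReal := by
    simpa using (ENNReal.toReal_lt_toReal ENNReal.one_ne_top hp'.ne).2 hp
  have hP0 : 0 < p.toReal := by linarith
  rw [← ENNReal.rpow_le_rpow_iff hP0, ENNReal.mul_rpow_of_nonneg _ _ hP0.le,
    eLpNorm_rpow_toReal hp hp', nnLpNorm, eLpNorm_rpow_toReal hp hp']
  exact lintegral_rpow_lconv_le hP hφ hψ h'φ h'ψ

variable [T2Space G]

/-- On a compact group, convolution by an `L^p` function is bounded on `L^p`. -/
theorem exists_normT_le_of_compactSpace [CompactSpace G] (hp : 1 < p) (hp' : p < ∞) :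
    ∃ K : ℝ≥0, 0 < K ∧ ∀ f : G → ℂ, MemLp f p μ →
      f ∈ LpT p μ ∧ normT p μ f ≤ K * eLpNorm f p μ := by
  have := isMulRightInvariant_of_compactSpace μ
  have := isInvInvariant_of_compactSpace μ
  set c : ℝ≥0∞ := μ univ ^ (1 / (1 : ℝ≥0∞).toReal - 1 / p.toReal) with hc
  have hP : 1 < p.toReal := by
    simpa using (ENNReal.toReal_lt_toReal ENNReal.one_ne_top hp'.ne).2 hp
  have hct : c ≠ ∞ := by
    refine ENNReal.rpow_ne_top_of_nonneg ?_ (measure_ne_top μ univ)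
    simp only [ENNReal.toReal_one, div_one, sub_nonneg]
    exact (div_le_one (by linarith)).2 hP.le
  have key (f : G → ℂ) (hf : MemLp f p μ) (ε : ℝ≥0∞) (hε : ε ≠ 0) (hεt : ε ≠ ∞) :
      f ∈ LpT p μ ∧ normT p μ f ≤ 2 * (c * (eLpNorm f p μ + ε)) := by
    obtain ⟨u, hu, h'u, hule, husum⟩ := exists_series_of_memLp hp.le hp'.ne hf hε
    have hκ : ∑' n, c * eLpNorm (u n) p μ ≤ c * (eLpNorm f p μ + ε) := by
      rw [ENNReal.tsum_mul_left]
      gcongr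
    have h1 := mem_LpT_of_series (κ := fun n => c * eLpNorm (u n) p μ) hp.le hp'.ne hf hu h'u
      (fun n φ hφ h'φ => ?_) (ne_top_of_le_ne_top (ENNReal.mul_ne_top hct
        (ENNReal.add_ne_top.2 ⟨hf.2.ne, hεt⟩)) hκ) (fun x => ?_)
    · exact ⟨h1.1, h1.2.trans (by gcongr)⟩
    · have hn : HasCompactSupport fun x => ‖u n x‖₊ :=
        (h'u n).comp_left (g := fun z : ℂ => ‖z‖₊) nnnorm_zero
      refine (eLpNorm_lconv_le hp hp' hφ (hu n).nnnorm h'φ hn).trans ?_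
      gcongr
      rw [lintegral_inv_eq_self (fun x => ((‖u n x‖₊ : ℝ≥0) : ℝ≥0∞))]
      have h2 := eLpNorm_le_eLpNorm_mul_rpow_measure_univ (μ := μ) hp.le
        (hu n).aestronglyMeasurable
      rw [eLpNorm_one_eq_lintegral_enorm, mul_comm] at h2
      exact h2
    -- The map `y ↦ y⁻¹ * x` preserves `μ`, so almost everywhere convergence of the series pulls
    -- back for every `x`.
    · exact ((measurePreserving_mul_right μ x).comp
        (Measure.measurePreserving_inv μ)).quasiMeasurePreserving.ae husum
  refine ⟨(2 * c).toNNReal + 1, by positivity, fun f hf => ⟨(key f hf 1 (by simp) (by simp)).1, ?_⟩⟩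
  have hc2 : ((2 * c).toNNReal : ℝ≥0∞) = 2 * c :=
    ENNReal.coe_toNNReal (ENNReal.mul_ne_top (by simp) hct)
  -- The series depends on `ε` but the operator norm does not, so `ε` may tend to `0`.
  have hlim : normT p μ f ≤ 2 * c * eLpNorm f p μ := by
    refine ge_of_tendsto (f := fun ε : ℝ≥0∞ => 2 * c * (eLpNorm f p μ + ε)) (x := 𝓝[>] 0) ?_ ?_
    · have h1 : Tendsto (fun ε : ℝ≥0∞ => 2 * c * (eLpNorm f p μ + ε)) (𝓝 0)
          (𝓝 (2 * c * (eLpNorm f p μ + 0))) :=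
        ENNReal.Tendsto.const_mul (tendsto_const_nhds.add tendsto_id)
          (.inr (ENNReal.mul_ne_top (by simp) hct))
      rw [add_zero] at h1
      exact h1.mono_left nhdsWithin_le_nhds
    · filter_upwards [Ioo_mem_nhdsGT (zero_lt_one (α := ℝ≥0∞))] with ε hε
      rw [mul_assoc]
      exact (key f hf ε hε.1.ne' (hε.2.trans_le le_top).ne).2
  refine hlim.trans ?_
  rw [ENNReal.coe_add, hc2]
  gcongr
  exact le_self_add

variable [LocallyCompactSpace G]

/-- On a unimodular group, continuous functions with compact support are `L^p`-tempered. -/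
theorem mem_LpT_of_hasCompactSupport [μ.Regular] [μ.IsMulRightInvariant] (hp : 1 < p)
    (hp' : p < ∞) {f : G → ℂ} (hf : Continuous f) (h'f : HasCompactSupport f) : f ∈ LpT p μ := by
  have hn : HasCompactSupport fun x => ‖f x‖₊ :=
    h'f.comp_left (g := fun z : ℂ => ‖z‖₊) nnnorm_zero
  have hI : ∫⁻ x, ‖f x⁻¹‖₊ ∂μ ≠ ∞ :=
    (lintegral_lt_top_of_hasCompactSupport (hf.nnnorm.comp continuous_inv)
      (hn.comp_homeomorph (Homeomorph.inv G)) μ).ne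
  -- A series with the single term `f`, bounded by Young's inequality.
  refine (mem_LpT_of_series (u := fun n => if n = 0 then f else 0)
    (κ := fun n => if n = 0 then ∫⁻ x, ‖f x⁻¹‖₊ ∂μ else 0) hp.le hp'.ne
    (hf.memLp_of_hasCompactSupport h'f) (fun n => ?_) (fun n => ?_) (fun n φ hφ h'φ => ?_) ?_
    fun x => .of_forall fun y => ?_).1
  · split_ifs
    · exact hf
    · exact continuous_zero
  · split_ifs
    · exact h'f
    · exact HasCompactSupport.zero
  · split_ifs
    · exact eLpNorm_lconv_le hp hp' hφ hf.nnnorm h'φ hn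
    · have : lconv μ φ (fun _ => ‖(0 : ℂ)‖₊) = 0 := by
        funext x
        simp [lconv]
      simp only [Pi.zero_apply]
      rw [this]
      simp
  · rw [tsum_ite_eq]
    exact hI
  · have h1 : (fun n : ℕ => (if n = 0 then f else 0) (y⁻¹ * x)) =
        fun n => if n = 0 then f (y⁻¹ * x) else 0 := by
      funext n
      split_ifs <;> rfl
    rw [h1]
    exact hasSum_ite_eq 0 _

/-- A tempered norm dominated by the `L^p` norm yields the convolution inequality. -/
theorem convBound_of_normT_le [μ.Regular] [μ.IsMulRightInvariant] (hp : 1 < p) (hp' : p < ∞)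
    {K : ℝ≥0} (H : ∀ f ∈ LpT p μ, normT p μ f ≤ K * eLpNorm f p μ) :
    ConvBound μ p.toReal ((K : ℝ≥0∞) ^ p.toReal) := by
  intro φ ψ hφ h'φ hψ h'ψ _ _
  have hP0 : 0 < p.toReal := ENNReal.toReal_pos (zero_lt_one.trans hp).ne' hp'.ne
  have hc {θ : G → ℝ≥0} (hθ : Continuous θ) : Continuous fun x => ((θ x : ℝ) : ℂ) := by fun_prop
  have hs {θ : G → ℝ≥0} (hθ : HasCompactSupport θ) :
      HasCompactSupport fun x => ((θ x : ℝ) : ℂ) :=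
    hθ.comp_left (g := fun r : ℝ≥0 => ((r : ℝ) : ℂ)) (by simp)
  have h1 := eLpNorm_conv_le_normT_mul p (zero_lt_one.trans hp).ne' μ (fun x => ((ψ x : ℝ) : ℂ))
    ((hc hφ).memLp_of_hasCompactSupport (p := p) (μ := μ) (hs h'φ))
  have h2 := H _ (mem_LpT_of_hasCompactSupport (μ := μ) hp hp' (hc hψ) (hs h'ψ))
  have h3 : eLpNorm (lconv μ φ ψ) p μ =
      eLpNorm (conv μ (fun x => ((φ x : ℝ) : ℂ)) fun x => ((ψ x : ℝ) : ℂ)) p μ := by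
    refine eLpNorm_congr_enorm_ae (.of_forall fun x => ?_)
    rw [enorm_eq_self, enorm_conv_coe]
    refine Continuous.integrable_of_hasCompactSupport
      ((hc hφ).mul ((hc hψ).comp (by fun_prop))) (hs h'φ).mul_right
  rw [eLpNorm_coe_nnreal] at h1 h2
  have h4 : eLpNorm (lconv μ φ ψ) p μ ≤ K * nnLpNorm p μ φ * nnLpNorm p μ ψ := by
    rw [h3]
    refine h1.trans ((mul_le_mul_left h2 _).trans_eq ?_)
    ring
  have h5 := ENNReal.rpow_le_rpow h4 hP0.le
  rw [ENNReal.mul_rpow_of_nonneg _ _ hP0.le, ENNReal.mul_rpow_of_nonneg _ _ hP0.le,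
    eLpNorm_rpow_toReal hp hp', nnLpNorm, nnLpNorm, eLpNorm_rpow_toReal hp hp',
    eLpNorm_rpow_toReal hp hp'] at h5
  exact h5

end Bounds

/-! ### Boundedness from temperedness of all of `L^p`. -/

section GlidingHump

variable {G : Type*} [TopologicalSpace G] [Group G] [MeasurableSpace G] [BorelSpace G]
  {μ : Measure G} [μ.IsHaarMeasure] {p : ℝ≥0∞}

/-- If all of `L^p` is tempered then the convolution inequality holds: gliding hump. -/
theorem exists_convBound_of_LpSet_subset (hp : 1 < p) (hp' : p < ∞)
    (H : LpSet p μ ⊆ LpT p μ) : ∃ C : ℝ≥0∞, C ≠ ∞ ∧ ConvBound μ p.toReal C := by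
  have hp0 : p ≠ 0 := (zero_lt_one.trans hp).ne'
  have hP : 1 < p.toReal := by
    simpa using (ENNReal.toReal_lt_toReal ENNReal.one_ne_top hp'.ne).2 hp
  have hP0 : 0 < p.toReal := by linarith
  by_contra! hcon
  -- Failure by a factor `4 ^ n` in norm survives the weight `2⁻¹ ^ n` below and leaves `2 ^ n`.
  have hbad (n : ℕ) := hcon (((4 : ℝ≥0∞) ^ n) ^ p.toReal)
    (ENNReal.rpow_ne_top_of_nonneg hP0.le (ENNReal.pow_ne_top (by simp)))
  simp only [ConvBound, not_forall, not_le] at hbad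
  choose φ ψ hφ h'φ hψ h'ψ hψ1 hψn hlt using hbad
  set N : ℕ → ℝ≥0 := fun n => (nnLpNorm p μ (ψ n)).toNNReal with hN
  have hNe (n : ℕ) : (N n : ℝ≥0∞) = nnLpNorm p μ (ψ n) :=
    ENNReal.coe_toNNReal (nnLpNorm_lt_top_of_hasCompactSupport (hψ n) (h'ψ n) p μ).ne
  have hlt' (n : ℕ) :
      (4 : ℝ≥0∞) ^ n * nnLpNorm p μ (φ n) * N n < eLpNorm (lconv μ (φ n) (ψ n)) p μ := by
    rw [← ENNReal.rpow_lt_rpow_iff hP0, hNe, ENNReal.mul_rpow_of_nonneg _ _ hP0.le,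
      ENNReal.mul_rpow_of_nonneg _ _ hP0.le, nnLpNorm, nnLpNorm, eLpNorm_rpow_toReal hp hp',
      eLpNorm_rpow_toReal hp hp', eLpNorm_rpow_toReal hp hp']
    exact hlt n
  have hN2 (n : ℕ) : 1 ≤ 2 * N n := by
    by_contra! h
    have h1 : (2 * N n : ℝ≥0∞) ^ p.toReal ≤ 2 * N n :=
      ENNReal.rpow_le_self_of_le_one (by exact_mod_cast h.le) hP.le
    have h2 : (2 : ℝ≥0∞) * (N n : ℝ≥0∞) ^ p.toReal ≤ (2 * N n : ℝ≥0∞) ^ p.toReal := by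
      rw [ENNReal.mul_rpow_of_nonneg _ _ hP0.le]
      gcongr
      exact ENNReal.le_rpow_self_of_one_le (by norm_num) hP.le
    have h3 : (1 : ℝ≥0∞) ≤ 2 * (N n : ℝ≥0∞) ^ p.toReal := by
      rw [hNe, nnLpNorm, eLpNorm_rpow_toReal hp hp']
      exact hψn n
    exact absurd (h3.trans (h2.trans h1)) (not_le.2 (by exact_mod_cast h))
  have hN0 (n : ℕ) : N n ≠ 0 := by
    intro h
    have := hN2 n
    simp [h] at this
  set c : ℕ → ℝ≥0 := fun n => (2⁻¹ : ℝ≥0) ^ n * (N n)⁻¹ with hc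
  have hc0 (n : ℕ) : c n ≠ 0 := mul_ne_zero (by positivity) (inv_ne_zero (hN0 n))
  have hc2 (n : ℕ) : c n ≤ 2 * (2⁻¹ : ℝ≥0) ^ n := by
    have : (N n)⁻¹ ≤ 2 := by
      rw [inv_le_iff_one_le_mul₀ (pos_iff_ne_zero.2 (hN0 n))]
      exact hN2 n
    rw [mul_comm 2]
    exact mul_le_mul' le_rfl this
  have hcN (n : ℕ) : (c n : ℝ≥0∞) * N n = (2⁻¹ : ℝ≥0∞) ^ n := by
    have h1 : c n * N n = (2⁻¹ : ℝ≥0) ^ n := by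
      rw [hc]
      exact inv_mul_cancel_right₀ (hN0 n) _
    rw [← ENNReal.coe_mul, h1]
    rw [ENNReal.coe_pow, ENNReal.coe_inv two_ne_zero, ENNReal.coe_ofNat]
  have hgeom : Summable fun n => 2 * (2⁻¹ : ℝ≥0) ^ n :=
    (NNReal.summable_geometric (by norm_num)).mul_left 2
  -- The two restrictions on `ψ` in `ConvBound` serve this step: the lower bound on the norm
  -- controls `c n`, and `ψ n ≤ 1` then gives convergence at every point, so no null set has to be
  -- carried through `y ↦ y⁻¹ * x`.
  have hsum (x : G) : Summable fun n => c n * ψ n x :=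
    NNReal.summable_of_le (fun n => (mul_le_of_le_one_right' (hψ1 n x)).trans (hc2 n)) hgeom
  set F : G → ℝ≥0 := fun x => ∑' n, c n * ψ n x with hF
  have hFe (x : G) : (F x : ℝ≥0∞) = ∑' n, (c n : ℝ≥0∞) * ψ n x := by
    rw [hF, ENNReal.coe_tsum (hsum x)]
    simp
  have hFm : Measurable F := Measurable.tsum fun n => ((hψ n).measurable.const_mul _)
  have hFN : nnLpNorm p μ F ≤ 2 := by
    calc nnLpNorm p μ F = eLpNorm (fun x => ∑' n, (c n : ℝ≥0∞) * ψ n x) p μ := by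
          simp only [nnLpNorm, hFe]
      _ ≤ ∑' n, eLpNorm (fun x => (c n : ℝ≥0∞) * ψ n x) p μ :=
          eLpNorm_tsum_le hp.le hp'.ne fun n =>
            ((hψ n).measurable.coe_nnreal_ennreal.const_mul _).aemeasurable
      _ = ∑' n, (2⁻¹ : ℝ≥0∞) ^ n := by
          refine tsum_congr fun n => ?_
          rw [eLpNorm_const_mul hp hp', ← hcN, hNe, nnLpNorm]
      _ = 2 := by rw [ENNReal.tsum_geometric]; simp
  have hmemF : MemLp (fun x => ((F x : ℝ) : ℂ)) p μ := by
    refine ⟨(Complex.measurable_ofReal.comp (measurable_coe_nnreal_real.comp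
      hFm)).aestronglyMeasurable, ?_⟩
    rw [eLpNorm_coe_nnreal]
    exact hFN.trans_lt (by simp)
  obtain ⟨-, hex, hfin⟩ := H hmemF
  have hbig (n : ℕ) : (2 : ℝ≥0∞) ^ n ≤ normT p μ fun x => ((F x : ℝ) : ℂ) := by
    have hmem : MemLp (fun x => ((φ n x : ℝ) : ℂ)) p μ := by
      refine Continuous.memLp_of_hasCompactSupport (by fun_prop) ?_
      exact (h'φ n).comp_left (g := fun r : ℝ≥0 => ((r : ℝ) : ℂ)) (by simp)
    have h1 := eLpNorm_conv_le_normT_mul p hp0 μ (fun x => ((F x : ℝ) : ℂ)) hmem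
    rw [eLpNorm_coe_nnreal] at h1
    have h2 : eLpNorm (lconv μ (φ n) F) p μ =
        eLpNorm (conv μ (fun x => ((φ n x : ℝ) : ℂ)) fun x => ((F x : ℝ) : ℂ)) p μ := by
      refine eLpNorm_congr_enorm_ae ?_
      filter_upwards [(hex _ hmem).1] with x hx
      rw [enorm_eq_self, enorm_conv_coe hx]
    have h3 : (c n : ℝ≥0∞) * eLpNorm (lconv μ (φ n) (ψ n)) p μ ≤
        eLpNorm (lconv μ (φ n) F) p μ := by
      rw [← eLpNorm_const_mul hp hp']
      refine eLpNorm_mono_enorm fun x => ?_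
      simp only [enorm_eq_self, lconv]
      rw [← lintegral_const_mul' _ _ ENNReal.coe_ne_top]
      refine lintegral_mono fun y => ?_
      rw [mul_left_comm]
      gcongr
      rw [hFe]
      exact ENNReal.le_tsum (f := fun n => (c n : ℝ≥0∞) * ψ n (y⁻¹ * x)) n
    -- Strictness allows the norm of `φ n` to be cancelled without checking separately that it is
    -- nonzero.
    have h4 : (2 : ℝ≥0∞) ^ n * nnLpNorm p μ (φ n) <
        (normT p μ fun x => ((F x : ℝ) : ℂ)) * nnLpNorm p μ (φ n) := by
      refine lt_of_lt_of_le ?_ (h3.trans (h2.trans_le h1))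
      have h5 := ENNReal.mul_lt_mul_right (by exact_mod_cast hc0 n : (c n : ℝ≥0∞) ≠ 0)
        ENNReal.coe_ne_top (hlt' n)
      refine lt_of_le_of_lt (le_of_eq ?_) h5
      have h7 : (2⁻¹ : ℝ≥0∞) ^ n * 4 ^ n = 2 ^ n := by
        rw [← mul_pow]
        congr 1
        rw [show (4 : ℝ≥0∞) = 2 * 2 by norm_num, ← mul_assoc,
          ENNReal.inv_mul_cancel (by simp) (by simp), one_mul]
      rw [← h7, ← hcN]
      ring
    exact (lt_of_mul_lt_mul_right' h4).le
  obtain ⟨n, hn⟩ := ENNReal.exists_nat_gt hfin.ne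
  refine absurd (hbig n) (not_le.2 (hn.trans ?_))
  exact_mod_cast n.lt_two_pow_self

end GlidingHump

end LpTempered

/-! ### Assembly of the equivalences. -/

theorem theoremt1 {G : Type*} [TopologicalSpace G] [Group G] [IsTopologicalGroup G]
    [LocallyCompactSpace G] [T2Space G] [MeasurableSpace G] [BorelSpace G]
    (μ : Measure G) [μ.IsHaarMeasure] [μ.Regular] (p : ℝ≥0∞) (hp : 1 < p) (hp' : p < ∞) :
    (LpTempered.LpSet p μ = LpTempered.LpT p μ ↔ CompactSpace G) ∧
    (LpTempered.NormsEquivalentOn (LpTempered.LpT p μ)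
        (fun f => eLpNorm f p μ) (LpTempered.normSumT p μ) ↔
      ∃ K : ℝ≥0, 0 < K ∧ ∀ f ∈ LpTempered.LpT p μ,
        LpTempered.normT p μ f ≤ K * eLpNorm f p μ) ∧
    (CompactSpace G →
      ∃ K : ℝ≥0, 0 < K ∧ ∀ f ∈ LpTempered.LpT p μ,
        LpTempered.normT p μ f ≤ K * eLpNorm f p μ) ∧
    (LpTempered.IsUnimodular G → p ≤ 2 →
      List.TFAE
        [LpTempered.LpSet p μ = LpTempered.LpT p μ,
         LpTempered.NormsEquivalentOn (LpTempered.LpT p μ)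
           (fun f => eLpNorm f p μ) (LpTempered.normSumT p μ),
         ∃ K : ℝ≥0, 0 < K ∧ ∀ f ∈ LpTempered.LpT p μ,
           LpTempered.normT p μ f ≤ K * eLpNorm f p μ,
         CompactSpace G]) := by
  have hP : 1 < p.toReal := by
    simpa using (ENNReal.toReal_lt_toReal ENNReal.one_ne_top hp'.ne).2 hp
  have h14 : LpTempered.LpSet p μ = LpTempered.LpT p μ ↔ CompactSpace G := by
    refine ⟨fun h => ?_, fun h => ?_⟩
    · obtain ⟨C, hC, H⟩ := LpTempered.exists_convBound_of_LpSet_subset hp hp' h.subset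
      exact H.compactSpace hP hC
    · obtain ⟨K, -, hK⟩ := LpTempered.exists_normT_le_of_compactSpace (μ := μ) hp hp'
      exact Set.Subset.antisymm (fun f hf => (hK f hf).1) fun f hf => hf.1
  have h23 : LpTempered.NormsEquivalentOn (LpTempered.LpT p μ)
        (fun f => eLpNorm f p μ) (LpTempered.normSumT p μ) ↔
      ∃ K : ℝ≥0, 0 < K ∧ ∀ f ∈ LpTempered.LpT p μ,
        LpTempered.normT p μ f ≤ K * eLpNorm f p μ := by
    refine ⟨fun ⟨c, C, _, hC, h⟩ => ⟨C, hC, fun f hf => ?_⟩,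
      fun ⟨K, _, h⟩ => ⟨1, 1 + K, one_pos, by positivity, fun f hf => ⟨?_, ?_⟩⟩⟩
    · exact le_add_self.trans (h f hf).2
    · rw [ENNReal.coe_one, one_mul]
      exact le_self_add
    · rw [ENNReal.coe_add, add_mul, ENNReal.coe_one, one_mul]
      exact add_le_add le_rfl (h f hf)
  have h43 : CompactSpace G → ∃ K : ℝ≥0, 0 < K ∧ ∀ f ∈ LpTempered.LpT p μ,
      LpTempered.normT p μ f ≤ K * eLpNorm f p μ := by
    intro h
    obtain ⟨K, hK0, hK⟩ := LpTempered.exists_normT_le_of_compactSpace (μ := μ) hp hp'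
    exact ⟨K, hK0, fun f hf => (hK f hf.1).2⟩
  refine ⟨h14, h23, h43, fun hG _ => ?_⟩
  have := hG.isMulRightInvariant μ
  tfae_have 1 ↔ 4 := h14
  tfae_have 2 ↔ 3 := h23
  tfae_have 4 → 3 := h43
  tfae_have 3 → 4 := fun ⟨K, _, hK⟩ =>
    (LpTempered.convBound_of_normT_le hp hp' hK).compactSpace hP
      (ENNReal.rpow_ne_top_of_nonneg (by linarith) ENNReal.coe_ne_top)
  tfae_finish
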